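/- Let $\mathcal H$ be a separable complex Hilbert space, let $J$ be a (possibly unbounded) skew-adjoint operator in $\mathcal H$ ($J^*=-J$) and $R$ a (possibly unbounded) non-negative self-adjoint operator in $\mathcal H$ ($R^*=R\ge 0$). Assume that $J$ is $R$-bounded with $R$-bound smaller than one, or that $R$ is $J$-bounded with $J$-bound smaller than one. Then $A:=J-R$ with domain $\operatorname{dom}J\cap\operatorname{dom}R$ generates a $C_0$-semigroup $(\mathcal T(t))_{t\ge 0}$ of contractions. Let $B:\mathbb C^m\to\mathcal H$ be linear and bounded and let $\mathbb U\subset\mathbb C^m$ be compact and convex with $0\in\operatorname{int}\mathbb U$. For $T>0$ put $\mathcal U_T:=\{u\in L^2(0,T;\mathbb C^m): u(t)\in\mathbb U\text{ for a.e. }t\}$, and for $x_0\in\mathcal H$, $u\in\mathcal U_T$, $t\in[0,T]$ let $$x(t;x_0,u):=\mathcal T(t)x_0+\int_0^t\mathcal T(t-s)Bu(s)\,ds$$ be the mild solution of $\dot x=Ax+Bu$, $x(0)=x_0$. Let $\mathcal R_T(x_0):=\{x(T;x_0,u):u\in\mathcal U_T\}$ for $T>0$, $\mathcal R_0(x_0):=\{x_0\}$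 and $\mathcal R(x_0):=\bigcup_{T\ge0}\mathcal R_T(x_0)$. For $x_0,x_T\in\mathcal H$ and $T>0$ consider the minimal-energy-supply problem $$\min_{u\in\mathcal U_T}\int_0^T\operatorname{Re}\langle u(t),y(t)\rangle\,dt,\qquad \dot x=(J-R)x+Bu,\quad y=B^*x,\quad x(0)=x_0,\quad x(T)=x_T, \tag{P}$$ where solutions are understood in the mild sense. **Theorem.** Assume that $0$ either belongs to the resolvent set $\rho(R)$ or is an eigenvalue of $R$ that is an isolated point of the spectrum $\sigma(R)$. Let $T_0>0$, let $\mathbb X:=\{x_0\in\mathcal H: 0\in\mathcal R_{T_0}(x_0)\}$, and let $x_T\in\mathcal R(0)$. Then (P) has the state integral turnpike property on $\mathbb X$ with respect to $\ker R$: there exist continuous functions $F,\tau:\mathbb X\to[0,\infty)$ such that for every $x_0\in\mathbb X$, every $T>\tau(x_0)$ and every optimal pair $(x^*,u^*)$ of (P) with initial state $x_0$ and horizon $T$, $$\int_0^T\operatorname{dist}^2(x^*(t),\ker R)\,dt\le F(x_0).$$ -/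

import Mathlib

open MeasureTheory Filter Topology
open scoped NNReal

noncomputable section

namespace PortHamiltonian

/-! ### Unbounded operators -/

section Operators

variable {H : Type*} [NormedAddCommGroup H] [InnerProductSpace ℂ H] [CompleteSpace H]

/-- A densely defined operator `J` with `J* = -J`. -/
def IsSkewAdjoint (J : H →ₗ.[ℂ] H) : Prop :=
  Dense (J.domain : Set H) ∧ J.adjoint = -J

/-- `R ≥ 0`, i.e. `⟨R x, x⟩ ≥ 0` on the domain of `R` (used for self-adjoint `R`, where the inner
product is real). -/
def IsNonneg (R : H →ₗ.[ℂ] H) : Prop :=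
  ∀ x : R.domain, 0 ≤ (inner ℂ (x : H) (R x)).re

/-- `S` is `T`-bounded with `T`-bound smaller than one. The `T`-bound is the infimum of all
`a ≥ 0` that admit a `b ≥ 0` with `‖S x‖ ≤ a ‖T x‖ + b ‖x‖` on `dom T ⊆ dom S`. -/
def IsRelBoundedLtOne (S T : H →ₗ.[ℂ] H) : Prop :=
  ∃ hdom : T.domain ≤ S.domain, ∃ a b : ℝ, 0 ≤ a ∧ a < 1 ∧ 0 ≤ b ∧
    ∀ x : T.domain, ‖S ⟨x, hdom x.2⟩‖ ≤ a * ‖T x‖ + b * ‖(x : H)‖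

/-- The resolvent set: all `s` such that `T - s : dom T → H` has an inverse in `L(H)`. -/
def resolventSet (T : H →ₗ.[ℂ] H) : Set ℂ :=
  {s | ∃ S : H →L[ℂ] H,
    (∀ y : H, ∃ hy : S y ∈ T.domain, T ⟨S y, hy⟩ - s • S y = y) ∧
    ∀ x : T.domain, S (T x - s • (x : H)) = x}

/-- The spectrum, the complement of the resolvent set. -/
def spectrum (T : H →ₗ.[ℂ] H) : Set ℂ := (resolventSet T)ᶜ

/-- `s` is an eigenvalue of `T`. -/
def IsEigenvalue (T : H →ₗ.[ℂ] H) (s : ℂ) : Prop :=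
  ∃ x : T.domain, (x : H) ≠ 0 ∧ T x = s • (x : H)

/-- The discrete spectrum: all eigenvalues that are isolated points of the spectrum. -/
def discreteSpectrum (T : H →ₗ.[ℂ] H) : Set ℂ :=
  {s | IsEigenvalue T s ∧ ∀ᶠ z in 𝓝[≠] s, z ∉ spectrum T}

/-- The kernel `{x ∈ dom T : T x = 0}` as a subspace of `H`. -/
def kernel (T : H →ₗ.[ℂ] H) : Submodule ℂ H :=
  (LinearMap.ker T.toFun).map T.domain.subtype

/-! ### Strongly continuous semigroups -/

/-- `S` is a `C₀`-semigroup; only the values `S t` with `t ≥ 0` matter. -/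
structure IsC0Semigroup (S : ℝ → H →L[ℂ] H) : Prop where
  map_zero : S 0 = ContinuousLinearMap.id ℂ H
  map_add : ∀ s t : ℝ, 0 ≤ s → 0 ≤ t → S (s + t) = (S s).comp (S t)
  tendsto_zero : ∀ x : H, Tendsto (fun t : ℝ => S t x) (𝓝[>] 0) (𝓝 x)

/-- `A` is the infinitesimal generator of `S`: one has `x ∈ dom A` and `A x = y` if and only if
`(S t x - x) / t → y` as `t ↓ 0`. -/
def IsGeneratorOf (A : H →ₗ.[ℂ] H) (S : ℝ → H →L[ℂ] H) : Prop :=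
  ∀ x y : H, (x, y) ∈ A.graph ↔
    Tendsto (fun t : ℝ => t⁻¹ • (S t x - x)) (𝓝[>] 0) (𝓝 y)

/-- `A` generates a `C₀`-semigroup. -/
def IsGenerator (A : H →ₗ.[ℂ] H) : Prop :=
  ∃ S : ℝ → H →L[ℂ] H, IsC0Semigroup S ∧ IsGeneratorOf A S

open Classical in
/-- The `C₀`-semigroup generated by `A` (it is unique on `[0, ∞)`), with the value `0` if `A` is
not a generator. -/
def semigroup (A : H →ₗ.[ℂ] H) : ℝ → H →L[ℂ] H :=
  if h : IsGenerator A then h.choose else 0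

theorem semigroup_spec {A : H →ₗ.[ℂ] H} (h : IsGenerator A) :
    IsC0Semigroup (semigroup A) ∧ IsGeneratorOf A (semigroup A) := by
  rw [semigroup, dif_pos h]
  exact h.choose_spec

end Operators

/-! ### The control system `x' = A x + B u` and optimal control problems for it -/

section Control

variable {H : Type*} [NormedAddCommGroup H] [InnerProductSpace ℂ H] [CompleteSpace H] {m : ℕ}

/-- The mild solution `x(t; x₀, u)` of `x' = A x + B u`, `x(0) = x₀`. -/
def mildSolution (A : H →ₗ.[ℂ] H) (B : EuclideanSpace ℂ (Fin m) →L[ℂ] H) (x₀ : H)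
    (u : ℝ → EuclideanSpace ℂ (Fin m)) (t : ℝ) : H :=
  semigroup A t x₀ + ∫ s in (0 : ℝ)..t, semigroup A (t - s) (B (u s))

/-- The control class of all `u ∈ L²(0, T; ℂᵐ)` with `u(t) ∈ U` for a.e. `t`. -/
def controls (U : Set (EuclideanSpace ℂ (Fin m))) (T : ℝ) :
    Set (ℝ → EuclideanSpace ℂ (Fin m)) :=
  {u | MemLp u 2 (volume.restrict (Set.Icc 0 T)) ∧
    ∀ᵐ t ∂(volume.restrict (Set.Icc 0 T)), u t ∈ U}

/-- The states that are reachable from `x₀` at time `T`. -/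
def reachableAt (A : H →ₗ.[ℂ] H) (B : EuclideanSpace ℂ (Fin m) →L[ℂ] H)
    (U : Set (EuclideanSpace ℂ (Fin m))) (T : ℝ) (x₀ : H) : Set H :=
  {x₁ | (T = 0 ∧ x₁ = x₀) ∨ (0 < T ∧ ∃ u ∈ controls U T, mildSolution A B x₀ u T = x₁)}

/-- The states that are reachable from `x₀` at some time `T ≥ 0`. -/
def reachable (A : H →ₗ.[ℂ] H) (B : EuclideanSpace ℂ (Fin m) →L[ℂ] H)
    (U : Set (EuclideanSpace ℂ (Fin m))) (x₀ : H) : Set H :=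
  ⋃ T : ℝ, ⋃ _ : 0 ≤ T, reachableAt A B U T x₀

/-- The controls in the class on `[0, T]` that steer `x₀` to `xT` at time `T`. -/
def admissibleControls (A : H →ₗ.[ℂ] H) (B : EuclideanSpace ℂ (Fin m) →L[ℂ] H)
    (U : Set (EuclideanSpace ℂ (Fin m))) (T : ℝ) (x₀ xT : H) :
    Set (ℝ → EuclideanSpace ℂ (Fin m)) :=
  {u | u ∈ controls U T ∧ mildSolution A B x₀ u T = xT}

/-- The cost `∫₀ᵀ ℓ(x(t), u(t)) dt` along the mild solution. -/
def cost (A : H →ₗ.[ℂ] H) (B : EuclideanSpace ℂ (Fin m) →L[ℂ] H)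
    (ℓ : H → EuclideanSpace ℂ (Fin m) → ℝ) (T : ℝ) (x₀ : H)
    (u : ℝ → EuclideanSpace ℂ (Fin m)) : ℝ :=
  ∫ t in (0 : ℝ)..T, ℓ (mildSolution A B x₀ u t) (u t)

/-- `(x, u)` is an optimal pair of the problem of minimizing `∫₀ᵀ ℓ(x(t), u(t)) dt` over the
control class subject to `x' = A x + B u`, `x(0) = x₀`, `x(T) = xT`. -/
def IsOptimalPair (A : H →ₗ.[ℂ] H) (B : EuclideanSpace ℂ (Fin m) →L[ℂ] H)
    (U : Set (EuclideanSpace ℂ (Fin m))) (ℓ : H → EuclideanSpace ℂ (Fin m) → ℝ) (T : ℝ)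
    (x₀ xT : H) (x : ℝ → H) (u : ℝ → EuclideanSpace ℂ (Fin m)) : Prop :=
  u ∈ admissibleControls A B U T x₀ xT ∧
    (∀ t ∈ Set.Icc 0 T, x t = mildSolution A B x₀ u t) ∧
    ∀ v ∈ admissibleControls A B U T x₀ xT, cost A B ℓ T x₀ u ≤ cost A B ℓ T x₀ v

/-- The state integral turnpike property, on a set `Stp` of initial states and with respect to a
subspace `V`, of the family (in `x₀` and `T`) of optimal control problems with stage cost `ℓ` and
terminal state `xT`. -/
def HasStateIntegralTurnpike (A : H →ₗ.[ℂ] H) (B : EuclideanSpace ℂ (Fin m) →L[ℂ] H)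
    (U : Set (EuclideanSpace ℂ (Fin m))) (ℓ : H → EuclideanSpace ℂ (Fin m) → ℝ) (xT : H)
    (Stp : Set H) (V : Submodule ℂ H) : Prop :=
  ∃ F τ : Stp → ℝ≥0, Continuous F ∧ Continuous τ ∧
    ∀ (x₀ : Stp) (T : ℝ), (τ x₀ : ℝ) < T →
      ∀ (x : ℝ → H) (u : ℝ → EuclideanSpace ℂ (Fin m)),
        IsOptimalPair A B U ℓ T x₀ xT x u →
          IntervalIntegrable (fun t => Metric.infDist (x t) (V : Set H) ^ 2) volume 0 T ∧
          ∫ t in (0 : ℝ)..T, Metric.infDist (x t) (V : Set H) ^ 2 ≤ (F x₀ : ℝ)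

/-- The supplied power `Re ⟨u, y⟩` with the output `y = B* x`. -/
def energySupply (B : EuclideanSpace ℂ (Fin m) →L[ℂ] H) (x : H)
    (u : EuclideanSpace ℂ (Fin m)) : ℝ :=
  (inner ℂ u (ContinuousLinearMap.adjoint B x)).re

end Control

end PortHamiltonian

end

/-! The stored energy `‖x‖² / 2` grows along a solution at the rate `Re ⟨x, B u⟩ - ⟨x, R x⟩`, since
a skew-adjoint `J` contributes nothing. The hypothesis on the spectrum says that `R` has a gap above
zero, so `⟨x, R x⟩ ≥ c dist(x, ker R)²` for some `c > 0` (`IsNonneg.exists_mul_infDist_sq_le`).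
Integration bounds `c ∫ dist²` by the supplied energy plus `‖x₀‖² / 2`, whatever the horizon
(`IsContractionSemigroup.mul_integral_infDist_sq_le`). An optimal control supplies no more energy
than any competitor. One competitor steers `x₀` to the origin in time `T₀`, rests there at no cost,
and leaves just in time to reach `xT`; its supply is bounded independently of `T`
(`exists_admissibleControl_supply_le`). Dividing by `c` gives `F`. Two points need analysis. The
semigroup of `J - R` must first exist: `J - R` is maximal dissipative (`exists_isMDissipative_sub`),
and Yosida approximation produces the semigroup (`IsMDissipative.isGenerator`). Moreover, mild
solutions need not be differentiable, so the energy inequality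
(`IsContractionSemigroup.sq_norm_mild_le`) is proved for solutions smoothed by resolvents and with
continuous inputs, and then passed to the limit. The gap estimate is transferred to the bounded
operator `(1 + R)⁻¹`, where the continuous functional calculus applies. -/

noncomputable section

namespace PortHamiltonian

/-! ### Accretive operators, relatively bounded perturbations, maximal dissipativity of `J - R` -/

section MaximalDissipative

variable {H : Type*} [NormedAddCommGroup H] [InnerProductSpace ℂ H]

/-- `A` is densely defined and dissipative, and `l - A` is onto for all `l > ω`. -/
structure IsMDissipative (A : H →ₗ.[ℂ] H) (ω : ℝ) : Prop where
  nonneg : 0 ≤ ω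
  dense : Dense (A.domain : Set H)
  dissipative : ∀ x : A.domain, (inner ℂ (x : H) (A x)).re ≤ 0
  surjective : ∀ l : ℝ, ω < l → ∀ y : H, ∃ x : A.domain, (l : ℂ) • (x : H) - A x = y

/-- The cross term `2 l Re ⟨x, y⟩` in the expanded square is non-negative. Keeping the first summand
on the left gives the resolvent bound; keeping the second controls `D (l + D)⁻¹`, which relative
boundedness requires. -/
theorem sq_norm_add_le_of_re_inner_nonneg {x y : H} (h : 0 ≤ (inner ℂ x y).re) {l : ℝ}
    (hl : 0 ≤ l) : (l * ‖x‖) ^ 2 + ‖y‖ ^ 2 ≤ ‖(l : ℂ) • x + y‖ ^ 2 := by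
  have h1 := norm_add_sq (𝕜 := ℂ) ((l : ℂ) • x) y
  have h2 : RCLike.re (inner ℂ ((l : ℂ) • x) y) = l * (inner ℂ x y).re := by
    rw [inner_smul_left]; simp
  rw [h1, h2, norm_smul, Complex.norm_real, Real.norm_of_nonneg hl]
  nlinarith [mul_nonneg hl h]

theorem mul_norm_le_of_re_inner_nonneg {x y : H} (h : 0 ≤ (inner ℂ x y).re) {l : ℝ}
    (hl : 0 ≤ l) : l * ‖x‖ ≤ ‖(l : ℂ) • x + y‖ := by
  have := sq_norm_add_le_of_re_inner_nonneg h hl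
  exact le_of_sq_le_sq (by nlinarith [sq_nonneg ‖y‖]) (norm_nonneg _)

theorem norm_le_of_re_inner_nonneg {x y : H} (h : 0 ≤ (inner ℂ x y).re) {l : ℝ}
    (hl : 0 ≤ l) : ‖y‖ ≤ ‖(l : ℂ) • x + y‖ := by
  have := sq_norm_add_le_of_re_inner_nonneg h hl
  exact le_of_sq_le_sq (by nlinarith [sq_nonneg (l * ‖x‖)]) (norm_nonneg _)

/-- The inverse of `l + D` for an accretive `D` with `l + D` onto. -/
theorem exists_resolvent_of_accretive {D : H →ₗ.[ℂ] H}
    (h0 : ∀ x : D.domain, 0 ≤ (inner ℂ (x : H) (D x)).re) {l : ℝ} (hl : 0 < l)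
    (hs : ∀ y : H, ∃ x : D.domain, (l : ℂ) • (x : H) + D x = y) :
    ∃ S : H →ₗ[ℂ] D.domain, (∀ y, (l : ℂ) • (S y : H) + D (S y) = y) ∧
      ∀ x : D.domain, S ((l : ℂ) • (x : H) + D x) = x := by
  set f : D.domain →ₗ[ℂ] H := (l : ℂ) • D.domain.subtype + D.toFun with hf
  have hfx : ∀ x : D.domain, f x = (l : ℂ) • (x : H) + D x := fun x => rfl
  have hinj : Function.Injective f := by
    rw [injective_iff_map_eq_zero]
    intro x hx
    have := mul_norm_le_of_re_inner_nonneg (h0 x) hl.le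
    rw [← hfx, hx, norm_zero] at this
    have h2 : ‖(x : H)‖ ≤ 0 := by
      by_contra hcon
      push Not at hcon
      nlinarith [mul_pos hl hcon]
    exact Subtype.ext (norm_le_zero_iff.1 h2)
  let e : D.domain ≃ₗ[ℂ] H := LinearEquiv.ofBijective f ⟨hinj, fun y => hs y⟩
  exact ⟨e.symm.toLinearMap, fun y => e.apply_symm_apply y, fun x => e.symm_apply_apply x⟩

variable [CompleteSpace H]

/-- The range of `l + D` is closed, by the lower bound `l ‖x‖ ≤ ‖(l + D) x‖` and closedness of the
graph. It is dense because a vector orthogonal to it satisfies `D* z = -l z`, which accretivity of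
`D*` permits only for `z = 0`. -/
theorem exists_smul_add_eq_of_accretive {D : H →ₗ.[ℂ] H} (hd : Dense (D.domain : Set H))
    (hc : D.IsClosed) (h0 : ∀ x : D.domain, 0 ≤ (inner ℂ (x : H) (D x)).re)
    (h0' : ∀ x : D.adjoint.domain, 0 ≤ (inner ℂ (x : H) (D.adjoint x)).re)
    {l : ℝ} (hl : 0 < l) (y : H) : ∃ x : D.domain, (l : ℂ) • (x : H) + D x = y := by
  set f : D.domain →ₗ[ℂ] H := (l : ℂ) • D.domain.subtype + D.toFun with hf
  have hfx : ∀ x : D.domain, f x = (l : ℂ) • (x : H) + D x := fun x => rfl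
  have hclosed : IsClosed (LinearMap.range f : Set H) := by
    refine IsSeqClosed.isClosed ?_
    intro v z hv hz
    choose x hx using hv
    have hcauchy : CauchySeq (fun n => (x n : H)) := by
      have hvc := hz.cauchySeq
      rw [Metric.cauchySeq_iff] at hvc ⊢
      intro ε hε
      obtain ⟨N, hN⟩ := hvc (l * ε) (by positivity)
      refine ⟨N, fun m hm n hn => ?_⟩
      have h1 := hN m hm n hn
      rw [dist_eq_norm, ← hx, ← hx, ← map_sub, hfx] at h1
      have h2 := mul_norm_le_of_re_inner_nonneg (h0 (x m - x n)) hl.le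
      rw [dist_eq_norm]
      have h3 : l * ‖(x m : H) - x n‖ < l * ε := lt_of_le_of_lt h2 h1
      exact lt_of_mul_lt_mul_left h3 hl.le
    obtain ⟨w, hw⟩ := cauchySeq_tendsto_of_complete hcauchy
    have hD : Tendsto (fun n => D (x n)) atTop (𝓝 (z - (l : ℂ) • w)) := by
      have : (fun n => D (x n)) = fun n => v n - (l : ℂ) • (x n : H) := by
        funext n; rw [← hx, hfx]; abel
      rw [this]
      exact hz.sub (hw.const_smul _)
    have hmem : (w, z - (l : ℂ) • w) ∈ D.graph :=
      hc.mem_of_tendsto (hw.prodMk_nhds hD) (Eventually.of_forall fun n => D.mem_graph (x n))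
    obtain ⟨x', h1, h2⟩ := (LinearPMap.mem_graph_iff D).1 hmem
    refine ⟨x', ?_⟩
    rw [hfx, h2, h1]
    exact add_sub_cancel _ _
  have horth : (LinearMap.range f)ᗮ = ⊥ := by
    rw [Submodule.eq_bot_iff]
    intro z hz
    have hz' : ∀ x : D.domain, inner ℂ (-((l : ℂ) • z)) (x : H) = inner ℂ z (D x) := by
      intro x
      have := Submodule.inner_left_of_mem_orthogonal (LinearMap.mem_range_self f x) hz
      rw [hfx, inner_add_right, inner_smul_right] at this
      rw [inner_neg_left, inner_smul_left, Complex.conj_ofReal]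
      linear_combination -this
    have hzd : z ∈ D.adjoint.domain := LinearPMap.mem_adjoint_domain_of_exists z ⟨_, hz'⟩
    have hza : D.adjoint ⟨z, hzd⟩ = -((l : ℂ) • z) :=
      LinearPMap.adjoint_apply_eq hd ⟨z, hzd⟩ hz'
    have h1 := h0' ⟨z, hzd⟩
    rw [hza] at h1
    have h2 : (inner ℂ z (-((l : ℂ) • z))).re = -(l * ‖z‖ ^ 2) := by
      rw [inner_neg_right, inner_smul_right, inner_self_eq_norm_sq_to_K, Complex.neg_re,
        Complex.re_ofReal_mul]
      norm_cast
    simp only at h1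
    rw [h2] at h1
    have : ‖z‖ ^ 2 ≤ 0 := by
      by_contra hcon
      push Not at hcon
      nlinarith [mul_pos hl hcon]
    exact norm_eq_zero.1 (pow_eq_zero_iff two_ne_zero |>.1 (le_antisymm this (sq_nonneg _)))
  have htop : LinearMap.range f = ⊤ := by
    rw [← hclosed.submodule_topologicalClosure_eq]
    exact (Submodule.topologicalClosure_eq_top_iff).2 horth
  obtain ⟨x, hx⟩ := LinearMap.range_eq_top.1 htop y
  exact ⟨x, by rw [← hfx, hx]⟩

/-- A relatively bounded perturbation with bound smaller than one keeps `l + D` onto for all large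
`l`. -/
theorem exists_smul_add_add_eq_of_relBounded {D E : H →ₗ.[ℂ] H}
    (h0 : ∀ x : D.domain, 0 ≤ (inner ℂ (x : H) (D x)).re)
    (hs : ∀ l : ℝ, 0 < l → ∀ y : H, ∃ x : D.domain, (l : ℂ) • (x : H) + D x = y)
    (hdom : D.domain ≤ E.domain) {a b : ℝ} (ha : 0 ≤ a) (ha1 : a < 1) (hb : 0 ≤ b)
    (hE : ∀ x : D.domain, ‖E ⟨x, hdom x.2⟩‖ ≤ a * ‖D x‖ + b * ‖(x : H)‖)
    {l : ℝ} (hl : b / (1 - a) < l) (y : H) :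
    ∃ x : D.domain, (l : ℂ) • (x : H) + D x + E ⟨x, hdom x.2⟩ = y := by
  have h1a : 0 < 1 - a := by linarith
  have hl0 : 0 < l := lt_of_le_of_lt (by positivity) hl
  obtain ⟨S, hS, -⟩ := exists_resolvent_of_accretive h0 hl0 (hs l hl0)
  have hDS : ∀ y, ‖D (S y)‖ ≤ ‖y‖ := fun y => by
    simpa only [hS] using norm_le_of_re_inner_nonneg (h0 (S y)) hl0.le
  have hSn : ∀ y, l * ‖(S y : H)‖ ≤ ‖y‖ := fun y => by
    simpa only [hS] using mul_norm_le_of_re_inner_nonneg (h0 (S y)) hl0.le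
  -- With `S = (l + D)⁻¹` one has `(l + D + E) S = 1 + E S`. The choice of `l` makes `‖E S‖ ≤ a + b
  -- / l < 1`, so a Neumann series inverts the right-hand side.
  let W₀ : H →ₗ[ℂ] H := E.toFun ∘ₗ (Submodule.inclusion hdom) ∘ₗ S
  have hW₀ : ∀ y, W₀ y = E ⟨S y, hdom (S y).2⟩ := fun y => rfl
  have hbound : ∀ y, ‖W₀ y‖ ≤ (a + b / l) * ‖y‖ := fun y => by
    rw [hW₀]
    refine (hE (S y)).trans ?_
    have e1 := mul_le_mul_of_nonneg_left (hDS y) ha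
    have e2 : b * ‖(S y : H)‖ ≤ b / l * ‖y‖ := by
      rw [div_mul_eq_mul_div, le_div_iff₀ hl0, mul_assoc]
      refine mul_le_mul_of_nonneg_left ?_ hb
      rw [mul_comm]; exact hSn y
    linarith
  let W : H →L[ℂ] H := W₀.mkContinuous (a + b / l) hbound
  have hWn : ‖-W‖ < 1 := by
    rw [norm_neg]
    refine (LinearMap.mkContinuous_norm_le _ (by positivity) hbound).trans_lt ?_
    have : b / l < 1 - a := by
      rw [div_lt_iff₀ hl0]
      rw [div_lt_iff₀ h1a] at hl
      linarith
    linarith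
  obtain ⟨G, hG⟩ := (isUnit_one_sub_of_norm_lt_one hWn).exists_right_inv
  refine ⟨S (G y), ?_⟩
  have h2 := congrArg (fun T : H →L[ℂ] H => T y) hG
  simp only [sub_neg_eq_add, mul_apply_eq_comp, add_apply, one_apply_eq_self] at h2
  rw [hS]
  exact h2

theorem IsSkewAdjoint.re_inner {J : H →ₗ.[ℂ] H} (hJ : IsSkewAdjoint J) (x : J.domain) :
    (inner ℂ (x : H) (J x)).re = 0 := by
  have h1 := LinearPMap.adjoint_isFormalAdjoint hJ.1
  rw [hJ.2] at h1
  have h2 := h1 x x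
  rw [LinearPMap.neg_apply, inner_neg_left] at h2
  have h3 := congrArg Complex.re h2
  rw [Complex.neg_re] at h3
  have h4 : (inner ℂ (J x) (x : H)).re = (inner ℂ (x : H) (J x)).re :=
    inner_re_symm (𝕜 := ℂ) _ _
  linarith

theorem IsSkewAdjoint.isClosed {J : H →ₗ.[ℂ] H} (hJ : IsSkewAdjoint J) : (-J).IsClosed := by
  rw [← hJ.2]
  exact LinearPMap.adjoint_isClosed hJ.1

/-- Solving `(l - J) x = y` uses accretivity of the adjoint of `-J`, so that adjoint has to be
identified. Formal adjointness gives one inclusion; for the other, the domain of `(-J)*` lies in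
that of `J* = -J`. -/
theorem IsSkewAdjoint.adjoint_neg {J : H →ₗ.[ℂ] H} (hJ : IsSkewAdjoint J) :
    (-J).adjoint = J := by
  have hd : Dense ((-J).domain : Set H) := hJ.1
  have hle : J ≤ (-J).adjoint := by
    refine LinearPMap.IsFormalAdjoint.le_adjoint hd ?_
    rw [← hJ.2]
    exact LinearPMap.adjoint_isFormalAdjoint hJ.1
  refine (LinearPMap.eq_of_le_of_domain_eq hle (le_antisymm hle.1 ?_)).symm
  intro y hy
  have : y ∈ J.adjoint.domain := by
    refine LinearPMap.mem_adjoint_domain_of_exists y ⟨-((-J).adjoint ⟨y, hy⟩), fun x => ?_⟩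
    have := LinearPMap.adjoint_isFormalAdjoint hd ⟨y, hy⟩ x
    rw [inner_neg_left, this, LinearPMap.neg_apply, inner_neg_right, neg_neg]
  rw [hJ.2] at this
  exact this

theorem IsSkewAdjoint.exists_smul_sub_eq {J : H →ₗ.[ℂ] H} (hJ : IsSkewAdjoint J) {l : ℝ}
    (hl : 0 < l) (y : H) : ∃ x : (-J).domain, (l : ℂ) • (x : H) + (-J) x = y := by
  refine exists_smul_add_eq_of_accretive (D := -J) hJ.1 hJ.isClosed (fun x => ?_) ?_ hl y
  · rw [LinearPMap.neg_apply, inner_neg_right, Complex.neg_re, hJ.re_inner x, neg_zero]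
  · rw [hJ.adjoint_neg]
    exact fun x => (hJ.re_inner x).ge

theorem IsNonneg.exists_smul_add_eq {R : H →ₗ.[ℂ] H} (hR : IsSelfAdjoint R) (hR0 : IsNonneg R)
    {l : ℝ} (hl : 0 < l) (y : H) : ∃ x : R.domain, (l : ℂ) • (x : H) + R x = y := by
  refine exists_smul_add_eq_of_accretive hR.dense_domain hR.isClosed hR0 ?_ hl y
  rw [LinearPMap.isSelfAdjoint_def.1 hR]
  exact hR0

theorem re_inner_sub_apply {J R : H →ₗ.[ℂ] H} (hJ : IsSkewAdjoint J) (x : (J - R).domain) :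
    (inner ℂ (x : H) ((J - R) x)).re = -(inner ℂ (x : H) (R ⟨x, x.2.2⟩)).re := by
  rw [LinearPMap.sub_apply, inner_sub_right, Complex.sub_re]
  have := hJ.re_inner ⟨x, x.2.1⟩
  simp only at this
  rw [this, zero_sub]

/-- The relatively bounded operator is the perturbation and the other one, `R` or `-J`, is the
accretive main part. The domain of `J - R` is then that of the main part, hence dense. -/
theorem exists_isMDissipative_sub {J R : H →ₗ.[ℂ] H} (hJ : IsSkewAdjoint J)
    (hR : IsSelfAdjoint R) (hR0 : IsNonneg R)
    (hJR : IsRelBoundedLtOne J R ∨ IsRelBoundedLtOne R J) :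
    ∃ ω, IsMDissipative (J - R) ω := by
  have hdiss : ∀ x : (J - R).domain, (inner ℂ (x : H) ((J - R) x)).re ≤ 0 := fun x => by
    rw [re_inner_sub_apply hJ]
    exact neg_nonpos.2 (hR0 ⟨x, x.2.2⟩)
  rcases hJR with ⟨hdom, a, b, ha, ha1, hb, h⟩ | ⟨hdom, a, b, ha, ha1, hb, h⟩
  · refine ⟨b / (1 - a), div_nonneg hb (by linarith), ?_, hdiss, fun l hl y => ?_⟩
    · rw [LinearPMap.sub_domain, inf_eq_right.2 hdom]
      exact hR.dense_domain
    · obtain ⟨x, hx⟩ := exists_smul_add_add_eq_of_relBounded (D := R) (E := -J) hR0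
        (fun l hl y => hR0.exists_smul_add_eq hR hl y) hdom ha ha1 hb
        (fun x => by rw [LinearPMap.neg_apply, norm_neg]; exact h x) hl y
      refine ⟨⟨x, hdom x.2, x.2⟩, ?_⟩
      rw [LinearPMap.sub_apply, ← hx, LinearPMap.neg_apply]
      simp only
      abel
  · refine ⟨b / (1 - a), div_nonneg hb (by linarith), ?_, hdiss, fun l hl y => ?_⟩
    · rw [LinearPMap.sub_domain, inf_eq_left.2 hdom]
      exact hJ.1
    · obtain ⟨x, hx⟩ := exists_smul_add_add_eq_of_relBounded (D := -J) (E := R)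
        (fun x => by
          rw [LinearPMap.neg_apply, inner_neg_right, Complex.neg_re, hJ.re_inner x, neg_zero])
        (fun l hl y => hJ.exists_smul_sub_eq hl y) hdom ha ha1 hb
        (fun x => by rw [LinearPMap.neg_apply, norm_neg]; exact h x) hl y
      refine ⟨⟨x, x.2, hdom x.2⟩, ?_⟩
      rw [LinearPMap.sub_apply, ← hx, LinearPMap.neg_apply, sub_sub_eq_add_sub, add_sub_right_comm,
        ← sub_eq_add_neg]
      rfl

end MaximalDissipative

/-! ### Resolvents, and exponentials of bounded dissipative operators -/

section HilleYosida

variable {H : Type*} [NormedAddCommGroup H] [InnerProductSpace ℂ H]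

/-- `G` is the inverse of `l - A`, with the resolvent bound of a dissipative operator. -/
structure IsResolvent (A : H →ₗ.[ℂ] H) (l : ℝ) (G : H →L[ℂ] H) : Prop where
  mem : ∀ y, G y ∈ A.domain
  right_inv : ∀ y, (l : ℂ) • G y - A ⟨G y, mem y⟩ = y
  left_inv : ∀ x : A.domain, G ((l : ℂ) • (x : H) - A x) = x
  norm_le : ∀ y, l * ‖G y‖ ≤ ‖y‖

theorem IsMDissipative.exists_isResolvent {A : H →ₗ.[ℂ] H} {ω : ℝ} (hA : IsMDissipative A ω)
    {l : ℝ} (hl : ω < l) : ∃ G : H →L[ℂ] H, IsResolvent A l G := by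
  have hl0 : 0 < l := hA.nonneg.trans_lt hl
  have h0 : ∀ x : (-A).domain, 0 ≤ (inner ℂ (x : H) ((-A) x)).re := fun x => by
    rw [LinearPMap.neg_apply, inner_neg_right, Complex.neg_re]
    exact neg_nonneg.2 (hA.dissipative x)
  obtain ⟨S, hS, hS'⟩ := exists_resolvent_of_accretive h0 hl0 fun y => by
    obtain ⟨x, hx⟩ := hA.surjective l hl y
    exact ⟨x, by rw [LinearPMap.neg_apply, ← sub_eq_add_neg]; exact hx⟩
  have hSn : ∀ y, l * ‖(S y : H)‖ ≤ ‖y‖ := fun y => by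
    simpa only [hS] using mul_norm_le_of_re_inner_nonneg (h0 (S y)) hl0.le
  refine ⟨((-A).domain.subtype ∘ₗ S).mkContinuous l⁻¹ fun y => ?_, fun y => (S y).2, fun y => ?_,
    fun x => ?_, hSn⟩
  · rw [inv_mul_eq_div, le_div_iff₀ hl0, mul_comm]
    exact hSn y
  · have := hS y
    rwa [LinearPMap.neg_apply, ← sub_eq_add_neg] at this
  · have := hS' x
    rw [LinearPMap.neg_apply, ← sub_eq_add_neg] at this
    exact congrArg Subtype.val this

theorem IsMDissipative.exists_isResolvent_seq {A : H →ₗ.[ℂ] H} {ω : ℝ} (hA : IsMDissipative A ω) :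
    ∃ (l : ℕ → ℝ) (G : ℕ → H →L[ℂ] H), Tendsto l atTop atTop ∧ (∀ n, 0 < l n) ∧
      ∀ n, IsResolvent A (l n) (G n) := by
  have h : ∀ n : ℕ, ω < n + (ω + 1) := fun n => by
    have : (0 : ℝ) ≤ n := n.cast_nonneg
    linarith
  choose G hG using fun n => hA.exists_isResolvent (h n)
  exact ⟨_, G, tendsto_atTop_add_const_right _ _ tendsto_natCast_atTop_atTop,
    fun n => hA.nonneg.trans_lt (h n), hG⟩

namespace IsResolvent

variable {A : H →ₗ.[ℂ] H} {l m : ℝ} {G K : H →L[ℂ] H}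

theorem sub_eq (hG : IsResolvent A l G) (hK : IsResolvent A m K) (y : H) :
    G y = K y + ((m : ℂ) - l) • G (K y) := by
  have h1 := hG.left_inv ⟨K y, hK.mem y⟩
  have h2 := hK.right_inv y
  have h3 : y = ((l : ℂ) • K y - A ⟨K y, hK.mem y⟩) + ((m : ℂ) - l) • K y := by
    refine h2.symm.trans ?_
    rw [sub_smul]
    abel
  nth_rewrite 1 [h3]
  rw [map_add, map_smul]
  exact congrArg (· + _) h1

/-- The resolvent identity expresses `G K` and `K G` by the same difference quotient; if the two
parameters coincide, so do the resolvents. -/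
theorem commute (hG : IsResolvent A l G) (hK : IsResolvent A m K) : Commute G K := by
  have h : ∀ y, ((m : ℂ) - l) • (G (K y) - K (G y)) = 0 := fun y => by
    have h1 := hG.sub_eq hK y
    have h2 := hK.sub_eq hG y
    have h3 : ((m : ℂ) - l) • G (K y) = G y - K y := by rw [h1]; abel
    have h4 : ((l : ℂ) - m) • K (G y) = K y - G y := by rw [h2]; abel
    rw [smul_sub, h3, ← neg_sub (l : ℂ) m, neg_smul, h4]
    abel
  by_cases hml : (m : ℂ) - l = 0
  · have : G = K := by
      ext y
      have := hG.sub_eq hK y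
      rwa [hml, zero_smul, add_zero] at this
    rw [this]
  · ext y
    have := (smul_eq_zero.1 (h y)).resolve_left hml
    exact sub_eq_zero.1 this

theorem norm_smul_le (hG : IsResolvent A l G) (hl : 0 < l) (y : H) :
    ‖(l : ℂ) • G y‖ ≤ ‖y‖ := by
  rw [norm_smul, Complex.norm_real, Real.norm_of_nonneg hl.le]
  exact hG.norm_le y

end IsResolvent

theorem tendsto_apply_of_dense {ι : Type*} {L : Filter ι} {T : ι → H →L[ℂ] H} {S : H →L[ℂ] H}
    (hT : ∀ᶠ i in L, ∀ x, ‖T i x‖ ≤ ‖x‖) (hS : ∀ x, ‖S x‖ ≤ ‖x‖) {D : Set H} (hD : Dense D)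
    (h : ∀ x ∈ D, Tendsto (fun i => T i x) L (𝓝 (S x))) (x : H) :
    Tendsto (fun i => T i x) L (𝓝 (S x)) := by
  rw [Metric.tendsto_nhds]
  intro ε hε
  obtain ⟨z, hz, hxz⟩ := hD.exists_dist_lt x (show 0 < ε / 3 by positivity)
  filter_upwards [hT, Metric.tendsto_nhds.1 (h z hz) (ε / 3) (by positivity)] with i hi h2
  have h1 : dist (T i x) (T i z) ≤ dist x z := by
    rw [dist_eq_norm, dist_eq_norm, ← map_sub]; exact hi _
  have h3 : dist (S z) (S x) ≤ dist z x := by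
    rw [dist_eq_norm, dist_eq_norm, ← map_sub]; exact hS _
  rw [dist_comm z x] at h3
  calc dist (T i x) (S x) ≤ dist (T i x) (T i z) + dist (T i z) (S z) + dist (S z) (S x) :=
        dist_triangle4 _ _ _ _
    _ < ε := by linarith

theorem cauchySeq_apply_of_dense {T : ℕ → H →L[ℂ] H} (hT : ∀ n x, ‖T n x‖ ≤ ‖x‖) {D : Set H}
    (hD : Dense D) (h : ∀ x ∈ D, CauchySeq fun n => T n x) (x : H) :
    CauchySeq fun n => T n x := by
  rw [Metric.cauchySeq_iff]
  intro ε hε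
  obtain ⟨z, hz, hxz⟩ := hD.exists_dist_lt x (show 0 < ε / 3 by positivity)
  obtain ⟨N, hN⟩ := Metric.cauchySeq_iff.1 (h z hz) (ε / 3) (by positivity)
  refine ⟨N, fun m hm n hn => ?_⟩
  have h1 : ∀ k, dist (T k x) (T k z) ≤ dist x z := fun k => by
    rw [dist_eq_norm, dist_eq_norm, ← map_sub]; exact hT k _
  have h2 := hN m hm n hn
  have h3 := h1 n
  rw [dist_comm] at h3
  calc dist (T m x) (T n x) ≤ dist (T m x) (T m z) + dist (T m z) (T n z) + dist (T n z) (T n x) :=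
        dist_triangle4 _ _ _ _
    _ < ε := by linarith [h1 m]

/-- On the domain, `l G x - x = G (A x)` has norm at most `‖A x‖ / l`. Since the `l G` are
contractions, density does the rest. -/
theorem tendsto_smul_resolvent {A : H →ₗ.[ℂ] H} (hd : Dense (A.domain : Set H)) {l : ℕ → ℝ}
    {G : ℕ → H →L[ℂ] H} (hl : Tendsto l atTop atTop) (hl0 : ∀ n, 0 < l n)
    (hG : ∀ n, IsResolvent A (l n) (G n)) (y : H) :
    Tendsto (fun n => (l n : ℂ) • G n y) atTop (𝓝 y) := by
  refine tendsto_apply_of_dense (T := fun n => (l n : ℂ) • G n) (S := ContinuousLinearMap.id ℂ H)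
    (Eventually.of_forall fun n x => (hG n).norm_smul_le (hl0 n) x) (fun x => le_rfl) hd ?_ y
  intro x hx
  rw [tendsto_iff_norm_sub_tendsto_zero]
  have h1 : Tendsto (fun n => (l n)⁻¹ * ‖A ⟨x, hx⟩‖) atTop (𝓝 0) := by
    simpa using (tendsto_inv_atTop_zero.comp hl).mul_const ‖A ⟨x, hx⟩‖
  refine squeeze_zero (fun _ => norm_nonneg _) (fun n => ?_) h1
  have h2 := (hG n).left_inv ⟨x, hx⟩
  rw [map_sub, map_smul] at h2
  have h3 : ((l n : ℂ) • G n) x - (ContinuousLinearMap.id ℂ H) x = G n (A ⟨x, hx⟩) := by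
    have : (l n : ℂ) • G n x - G n (A ⟨x, hx⟩) = x := h2
    change (l n : ℂ) • G n x - x = _
    nth_rewrite 2 [← this]
    abel
  rw [h3, inv_mul_eq_div, le_div_iff₀ (hl0 n), mul_comm]
  exact (hG n).norm_le _

theorem hasDerivWithinAt_norm_sq {f : ℝ → H} {f' : H} {s : Set ℝ} {t : ℝ}
    (h : HasDerivWithinAt f f' s t) :
    HasDerivWithinAt (fun r => ‖f r‖ ^ 2) (2 * (inner ℂ (f t) f').re) s t := by
  have h1 := (Complex.reCLM.hasFDerivAt).comp_hasDerivWithinAt t (h.inner ℂ h)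
  have h2 : (fun r => ‖f r‖ ^ 2) = Complex.reCLM ∘ fun r => inner ℂ (f r) (f r) := by
    funext r
    simp only [Function.comp, Complex.reCLM_apply]
    rw [inner_self_eq_norm_sq_to_K]
    norm_cast
  rw [h2]
  convert! h1 using 1
  rw [Complex.reCLM_apply, Complex.add_re, show (inner ℂ f' (f t)).re = (inner ℂ (f t) f').re from
    inner_re_symm (𝕜 := ℂ) _ _]
  ring

variable [CompleteSpace H]

theorem hasDerivAt_exp_smul_apply (X : H →L[ℂ] H) (x : H) (t : ℝ) :
    HasDerivAt (fun s : ℝ => NormedSpace.exp (s • X) x) (X (NormedSpace.exp (t • X) x)) t := by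
  have h := hasDerivAt_exp_smul_const' (𝕂 := ℝ) X t
  exact ((ContinuousLinearMap.apply ℂ H x).restrictScalars ℝ).hasFDerivAt.comp_hasDerivAt t h

theorem norm_exp_smul_apply_le {X : H →L[ℂ] H} (hX : ∀ x, (inner ℂ x (X x)).re ≤ 0) {t : ℝ}
    (ht : 0 ≤ t) (x : H) : ‖NormedSpace.exp (t • X) x‖ ≤ ‖x‖ := by
  have hder : ∀ s : ℝ, HasDerivAt (fun s : ℝ => ‖NormedSpace.exp (s • X) x‖ ^ 2)
      (2 * (inner ℂ (NormedSpace.exp (s • X) x) (X (NormedSpace.exp (s • X) x))).re) s := fun s =>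
    (hasDerivWithinAt_norm_sq (hasDerivAt_exp_smul_apply X x s).hasDerivWithinAt).hasDerivAt
      univ_mem
  have hanti : Antitone fun s : ℝ => ‖NormedSpace.exp (s • X) x‖ ^ 2 := by
    refine antitone_of_deriv_nonpos (fun s => (hder s).differentiableAt) fun s => ?_
    rw [(hder s).deriv]
    linarith [hX (NormedSpace.exp (s • X) x)]
  have := hanti ht
  simp only [zero_smul, NormedSpace.exp_zero, one_apply_eq_self] at this
  exact le_of_sq_le_sq this (norm_nonneg _)

/-- The path `s ↦ exp((t - s) Y) exp(s X) x` joins the two vectors. Commutation makes its derivative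
`exp((t - s) Y) exp(s X) (X x - Y x)`, and both exponentials contract. -/
theorem norm_exp_smul_sub_exp_smul_le {X Y : H →L[ℂ] H} (hX : ∀ x, (inner ℂ x (X x)).re ≤ 0)
    (hY : ∀ x, (inner ℂ x (Y x)).re ≤ 0) (hXY : Commute X Y) {t : ℝ} (ht : 0 ≤ t) (x : H) :
    ‖NormedSpace.exp (t • X) x - NormedSpace.exp (t • Y) x‖ ≤ ‖X x - Y x‖ * t := by
  have hder : ∀ s : ℝ, HasDerivAt
      (fun s : ℝ => (NormedSpace.exp ((t - s) • Y) * NormedSpace.exp (s • X)) x)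
      ((NormedSpace.exp ((t - s) • Y) * NormedSpace.exp (s • X)) (X x - Y x)) s := by
    intro s
    have h1 := hasDerivAt_exp_smul_const (𝕂 := ℝ) X s
    have h2 := (hasDerivAt_exp_smul_const (𝕂 := ℝ) Y (t - s)).comp_const_sub t s
    have h3 := h2.mul h1
    have h4 :=
      ((ContinuousLinearMap.apply ℂ H x).restrictScalars ℝ).hasFDerivAt.comp_hasDerivAt s h3
    refine h4.congr_deriv ?_
    have hc : Commute Y (NormedSpace.exp (s • X)) :=
      ((hXY.symm).smul_right s).exp_right
    change (-(NormedSpace.exp ((t - s) • Y) * Y) * NormedSpace.exp (s • X)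
      + NormedSpace.exp ((t - s) • Y) * (NormedSpace.exp (s • X) * X)) x = _
    have e : -(NormedSpace.exp ((t - s) • Y) * Y) * NormedSpace.exp (s • X)
      + NormedSpace.exp ((t - s) • Y) * (NormedSpace.exp (s • X) * X) =
      (NormedSpace.exp ((t - s) • Y) * NormedSpace.exp (s • X)) * (X - Y) := by
      rw [neg_mul, mul_assoc, hc.eq, mul_sub, mul_assoc, mul_assoc]
      abel
    rw [e]
    rfl
  have h := norm_image_sub_le_of_norm_deriv_le_segment' (a := 0) (b := t)
    (fun s _ => (hder s).hasDerivWithinAt) (C := ‖X x - Y x‖) (fun s hs => ?_) t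
    (Set.right_mem_Icc.2 ht)
  · simpa [NormedSpace.exp_zero] using h
  · exact (norm_exp_smul_apply_le hY (by linarith [hs.2]) _).trans
      (norm_exp_smul_apply_le hX hs.1 _)

theorem norm_exp_smul_sub_self_le {X : H →L[ℂ] H} (hX : ∀ x, (inner ℂ x (X x)).re ≤ 0) {t : ℝ}
    (ht : 0 ≤ t) (x : H) : ‖NormedSpace.exp (t • X) x - x‖ ≤ ‖X x‖ * t := by
  have := norm_exp_smul_sub_exp_smul_le hX (Y := 0) (by simp) (Commute.zero_right X) ht x
  simpa [NormedSpace.exp_zero] using this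

/-- In the application `X` is a Yosida approximation and `y = A x`, which may lie outside the domain
of `A`, so `X y` need not stay bounded. The auxiliary `z` is a nearby domain vector, for which `X z`
converges. -/
theorem norm_exp_smul_sub_sub_le {X : H →L[ℂ] H} (hX : ∀ x, (inner ℂ x (X x)).re ≤ 0) {t : ℝ}
    (ht : 0 ≤ t) (x y z : H) :
    ‖NormedSpace.exp (t • X) x - x - t • y‖ ≤ (‖X x - y‖ + 2 * ‖y - z‖ + t * ‖X z‖) * t := by
  have hder : ∀ s : ℝ, HasDerivAt (fun s : ℝ => NormedSpace.exp (s • X) x - s • y)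
      (NormedSpace.exp (s • X) (X x) - y) s := by
    intro s
    have h1 := hasDerivAt_exp_smul_const (𝕂 := ℝ) X s
    have h2 :=
      ((ContinuousLinearMap.apply ℂ H x).restrictScalars ℝ).hasFDerivAt.comp_hasDerivAt s h1
    have h3 := (hasDerivAt_id s).smul_const y
    rw [one_smul] at h3
    exact h2.sub h3
  have h := norm_image_sub_le_of_norm_deriv_le_segment' (a := 0) (b := t)
    (fun s _ => (hder s).hasDerivWithinAt) (C := ‖X x - y‖ + 2 * ‖y - z‖ + t * ‖X z‖)
    (fun s hs => ?_) t (Set.right_mem_Icc.2 ht)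
  · have e : NormedSpace.exp (t • X) x - x - t • y =
        NormedSpace.exp (t • X) x - t • y - (NormedSpace.exp ((0 : ℝ) • X) x - (0 : ℝ) • y) := by
      rw [zero_smul, zero_smul, NormedSpace.exp_zero, one_apply_eq_self, sub_zero]
      abel
    rw [e]
    simpa using h
  · have e : NormedSpace.exp (s • X) (X x) - y = NormedSpace.exp (s • X) (X x - y)
        + NormedSpace.exp (s • X) (y - z) + (NormedSpace.exp (s • X) z - z) + (z - y) := by
      rw [map_sub, map_sub]; abel
    rw [e]
    have h1 := norm_exp_smul_apply_le hX hs.1 (X x - y)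
    have h2 := norm_exp_smul_apply_le hX hs.1 (y - z)
    have h3 := norm_exp_smul_sub_self_le hX hs.1 z
    have h4 : ‖X z‖ * s ≤ t * ‖X z‖ := by
      rw [mul_comm]; exact mul_le_mul_of_nonneg_right hs.2.le (norm_nonneg _)
    have h5 := norm_add₃_le (a := NormedSpace.exp (s • X) (X x - y))
      (b := NormedSpace.exp (s • X) (y - z)) (c := NormedSpace.exp (s • X) z - z)
    have h6 := norm_add_le (NormedSpace.exp (s • X) (X x - y)
        + NormedSpace.exp (s • X) (y - z) + (NormedSpace.exp (s • X) z - z)) (z - y)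
    rw [norm_sub_rev z y] at h6
    linarith

end HilleYosida

/-! ### Yosida approximation and the generation theorem -/

section Generation

variable {H : Type*} [NormedAddCommGroup H] [InnerProductSpace ℂ H]

/-- The Yosida approximation `l² (l - A)⁻¹ - l` of `A`. -/
def yosida (l : ℝ) (G : H →L[ℂ] H) : H →L[ℂ] H :=
  ((l : ℂ) * l) • G - (l : ℂ) • 1

theorem yosida_apply (l : ℝ) (G : H →L[ℂ] H) (x : H) :
    yosida l G x = (l : ℂ) • ((l : ℂ) • G x - x) := by
  rw [smul_sub, smul_smul]
  rfl

theorem IsResolvent.smul_apply_sub {A : H →ₗ.[ℂ] H} {l : ℝ} {G : H →L[ℂ] H}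
    (hG : IsResolvent A l G) (x : A.domain) : (l : ℂ) • G x - x = G (A x) := by
  have h := hG.left_inv x
  rw [map_sub, map_smul] at h
  nth_rewrite 2 [← h]
  abel

/-- With `z = G x` one has `x = l z - A z`, and the approximation sends `x` to `l A z`. The real
part is therefore `l (l Re ⟨z, A z⟩ - ‖A z‖²)`. -/
theorem re_inner_yosida_nonpos {A : H →ₗ.[ℂ] H}
    (hA : ∀ x : A.domain, (inner ℂ (x : H) (A x)).re ≤ 0) {l : ℝ} (hl : 0 < l) {G : H →L[ℂ] H}
    (hG : IsResolvent A l G) (x : H) : (inner ℂ x (yosida l G x)).re ≤ 0 := by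
  set z : A.domain := ⟨G x, hG.mem x⟩ with hz
  have h1 : (l : ℂ) • (z : H) - A z = x := hG.right_inv x
  have h2 : (l : ℂ) • G x - x = A z := by
    nth_rewrite 2 [← h1]
    simp only [hz]
    abel
  rw [yosida_apply, h2]
  nth_rewrite 1 [← h1]
  rw [inner_smul_right, Complex.re_ofReal_mul, inner_sub_left, inner_smul_left,
    Complex.conj_ofReal, Complex.sub_re, Complex.re_ofReal_mul, inner_self_eq_norm_sq_to_K]
  have h3 : (((‖A z‖ : ℂ)) ^ 2).re = ‖A z‖ ^ 2 := by norm_cast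
  have h4 : l * (inner ℂ (z : H) (A z)).re ≤ 0 := mul_nonpos_of_nonneg_of_nonpos hl.le (hA z)
  refine mul_nonpos_of_nonneg_of_nonpos hl.le ?_
  have h5 := sq_nonneg ‖A z‖
  have h6 : ((RCLike.ofReal ‖A z‖ : ℂ) ^ 2).re = ‖A z‖ ^ 2 := h3
  rw [h6]
  linarith

variable [CompleteSpace H]

/-- The generation theorem for maximal dissipative operators: the semigroup is obtained as the
limit of the exponentials of the Yosida approximations. -/
theorem IsMDissipative.isGenerator {A : H →ₗ.[ℂ] H} {ω : ℝ} (hA : IsMDissipative A ω) :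
    IsGenerator A := by
  obtain ⟨l, G, hl, hl0, hG⟩ := hA.exists_isResolvent_seq
  set X : ℕ → H →L[ℂ] H := fun n => yosida (l n) (G n) with hXdef
  have hX : ∀ n x, (inner ℂ x (X n x)).re ≤ 0 := fun n x =>
    re_inner_yosida_nonpos hA.dissipative (hl0 n) (hG n) x
  have hcomm : ∀ n k, Commute (X n) (X k) := fun n k =>
    ((((hG n).commute (hG k)).smul_left _).sub_left ((Commute.one_left _).smul_left _)).smul_right _
      |>.sub_right ((Commute.one_right _).smul_right _)
  have hXA : ∀ x : A.domain, Tendsto (fun n => X n x) atTop (𝓝 (A x)) := fun x => by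
    have h := tendsto_smul_resolvent hA.dense hl hl0 hG (A x)
    refine h.congr fun n => ?_
    rw [hXdef]
    simp only
    rw [yosida_apply, (hG n).smul_apply_sub]
  have hcontr : ∀ t : ℝ, 0 ≤ t → ∀ n x, ‖NormedSpace.exp (t • X n) x‖ ≤ ‖x‖ := fun t ht n x =>
    norm_exp_smul_apply_le (hX n) ht x
  have hcauchy : ∀ t : ℝ, 0 ≤ t → ∀ x, CauchySeq fun n => NormedSpace.exp (t • X n) x := by
    intro t ht
    refine cauchySeq_apply_of_dense (fun n x => hcontr t ht n x) hA.dense fun x hx => ?_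
    have hc := (hXA ⟨x, hx⟩).cauchySeq
    rw [Metric.cauchySeq_iff] at hc ⊢
    intro ε hε
    obtain ⟨N, hN⟩ := hc (ε / (t + 1)) (by positivity)
    refine ⟨N, fun m hm n hn => ?_⟩
    have h1 := hN m hm n hn
    rw [lt_div_iff₀ (by positivity), dist_eq_norm] at h1
    rw [dist_eq_norm]
    refine (norm_exp_smul_sub_exp_smul_le (hX m) (hX n) (hcomm m n) ht x).trans_lt ?_
    have h2 := norm_nonneg (X m x - X n x)
    have h3 : ‖X m x - X n x‖ * (t + 1) < ε := h1
    linarith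
  -- The truncation `max t 0` only makes the family total in `t`; negative times play no role.
  have hex : ∀ t : ℝ, ∃ S : H →L[ℂ] H, ∀ x,
      Tendsto (fun n => NormedSpace.exp ((max t 0) • X n) x) atTop (𝓝 (S x)) := by
    intro t
    choose f hf using fun x => cauchySeq_tendsto_of_complete (hcauchy _ (le_max_right t 0) x)
    exact ⟨continuousLinearMapOfTendsto (fun n => NormedSpace.exp ((max t 0) • X n))
      (tendsto_pi_nhds.2 hf), hf⟩
  choose S hS' using hex
  have hS : ∀ t : ℝ, 0 ≤ t → ∀ x,
      Tendsto (fun n => NormedSpace.exp (t • X n) x) atTop (𝓝 (S t x)) := fun t ht x => by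
    simpa only [max_eq_left ht] using hS' t x
  have hSc : ∀ t : ℝ, 0 ≤ t → ∀ x, ‖S t x‖ ≤ ‖x‖ := fun t ht x =>
    le_of_tendsto (hS t ht x).norm (Eventually.of_forall fun n => hcontr t ht n x)
  have hSlip : ∀ t : ℝ, 0 ≤ t → ∀ x : A.domain, ‖S t x - x‖ ≤ ‖A x‖ * t := fun t ht x =>
    le_of_tendsto_of_tendsto ((hS t ht x).sub_const _).norm ((hXA x).norm.mul_const t)
      (Eventually.of_forall fun n => norm_exp_smul_sub_self_le (hX n) ht x)
  have hSder : ∀ t : ℝ, 0 ≤ t → ∀ x z : A.domain,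
      ‖S t x - x - t • A x‖ ≤ (‖A x - A x‖ + 2 * ‖A x - z‖ + t * ‖A z‖) * t := fun t ht x z =>
    le_of_tendsto_of_tendsto (((hS t ht x).sub_const _).sub_const _).norm
      ((((((hXA x).sub_const _).norm).add_const _).add ((hXA z).norm.const_mul t)).mul_const t)
      (Eventually.of_forall fun n => norm_exp_smul_sub_sub_le (hX n) ht x (A x) z)
  have hgen : ∀ x : A.domain, Tendsto (fun t : ℝ => t⁻¹ • (S t x - x)) (𝓝[>] 0) (𝓝 (A x)) := by
    intro x
    rw [Metric.tendsto_nhds]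
    intro ε hε
    obtain ⟨z, hz, hxz⟩ := hA.dense.exists_dist_lt (A x) (show 0 < ε / 4 by positivity)
    rw [dist_eq_norm] at hxz
    have hsmall : ∀ᶠ t : ℝ in 𝓝[>] 0, t * ‖A ⟨z, hz⟩‖ < ε / 2 := by
      have : Tendsto (fun t : ℝ => t * ‖A ⟨z, hz⟩‖) (𝓝[>] 0) (𝓝 0) := by
        have h : Continuous fun t : ℝ => t * ‖A ⟨z, hz⟩‖ := by fun_prop
        simpa using (h.tendsto 0).mono_left nhdsWithin_le_nhds
      exact this.eventually (gt_mem_nhds (by positivity))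
    filter_upwards [hsmall, self_mem_nhdsWithin] with t h1 (ht : 0 < t)
    have h2 := hSder t ht.le x ⟨z, hz⟩
    rw [sub_self, norm_zero, zero_add] at h2
    have h3 : t⁻¹ • (S t x - (x : H)) - A x = t⁻¹ • (S t x - x - t • A x) := by
      rw [smul_sub _ _ (t • A x), inv_smul_smul₀ ht.ne']
    rw [dist_eq_norm, h3, norm_smul, norm_inv, Real.norm_of_nonneg ht.le, inv_mul_lt_iff₀ ht,
      mul_comm]
    refine h2.trans_lt (mul_lt_mul_of_pos_right ?_ ht)
    simp only
    linarith
  refine ⟨S, ⟨?_, ?_, ?_⟩, ?_⟩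
  · ext x
    refine tendsto_nhds_unique (hS 0 le_rfl x) ?_
    simp only [zero_smul, NormedSpace.exp_zero, one_apply_eq_self]
    exact tendsto_const_nhds
  · intro s t hs ht
    ext x
    refine tendsto_nhds_unique (hS (s + t) (add_nonneg hs ht) x) ?_
    -- The inner factor also moves with `n`. Its error is carried through the contraction `exp(s X
    -- n)` and vanishes in the limit.
    have h1 : ∀ n, NormedSpace.exp ((s + t) • X n) x =
        NormedSpace.exp (s • X n) (S t x) +
          NormedSpace.exp (s • X n) (NormedSpace.exp (t • X n) x - S t x) := fun n => by
      let : NormedAlgebra ℚ (H →L[ℂ] H) := NormedAlgebra.restrictScalars ℚ ℂ (H →L[ℂ] H)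
      rw [add_smul, NormedSpace.exp_add_of_commute
        (((Commute.refl (X n)).smul_left s).smul_right t), ← map_add, add_sub_cancel]
      rfl
    simp only [h1]
    have h2 : Tendsto (fun n => NormedSpace.exp (s • X n) (NormedSpace.exp (t • X n) x - S t x))
        atTop (𝓝 0) := by
      refine squeeze_zero_norm (fun n => hcontr s hs n _) ?_
      exact tendsto_iff_norm_sub_tendsto_zero.1 (hS t ht x)
    simpa using (hS s hs (S t x)).add h2
  · refine tendsto_apply_of_dense (S := ContinuousLinearMap.id ℂ H) ?_ (fun x => le_rfl) hA.dense
      fun x hx => ?_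
    · filter_upwards [self_mem_nhdsWithin] with t (ht : 0 < t) using hSc t ht.le
    · rw [tendsto_iff_norm_sub_tendsto_zero]
      have h : Tendsto (fun t : ℝ => ‖A ⟨x, hx⟩‖ * t) (𝓝[>] 0) (𝓝 0) := by
        have h : Continuous fun t : ℝ => ‖A ⟨x, hx⟩‖ * t := by fun_prop
        simpa using (h.tendsto 0).mono_left nhdsWithin_le_nhds
      refine squeeze_zero' (Eventually.of_forall fun _ => norm_nonneg _) ?_ h
      filter_upwards [self_mem_nhdsWithin] with t (ht : 0 < t) using hSlip t ht.le ⟨x, hx⟩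
  · intro x y
    constructor
    · intro hxy
      obtain ⟨x', rfl, rfl⟩ := (LinearPMap.mem_graph_iff A).1 hxy
      exact hgen x'
    · intro hxy
      have hω : ω < ω + 1 := by linarith
      have hω0 : 0 < ω + 1 := by linarith [hA.nonneg]
      -- Maximality: put `λ = ω + 1` and choose `z` in the domain with `λ z - A z = λ x - y`. The
      -- difference quotients at `w = x - z` then tend to `λ w`. Contractivity forces `Re ⟨w, λ w⟩ ≤
      -- 0`, so `w = 0`.
      obtain ⟨z, hz⟩ := hA.surjective (ω + 1) hω (((ω + 1 : ℝ) : ℂ) • x - y)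
      have h1 := hxy.sub (hgen z)
      have h2 : Tendsto (fun t : ℝ => t⁻¹ • (S t (x - z) - (x - z))) (𝓝[>] 0)
          (𝓝 (y - A z)) := by
        refine h1.congr fun t => ?_
        rw [← smul_sub, map_sub]
        congr 1
        abel
      have h3 : y - A z = ((ω + 1 : ℝ) : ℂ) • (x - z) := by
        rw [smul_sub, ← sub_eq_zero]
        rw [← sub_eq_zero] at hz
        rw [← hz]
        abel
      rw [h3] at h2
      have h4 : (inner ℂ (x - z) (((ω + 1 : ℝ) : ℂ) • (x - (z : H)))).re ≤ 0 := by
        have h5 : Tendsto (fun t : ℝ => (inner ℂ (x - (z : H)) (t⁻¹ • (S t (x - z) - (x - z)))).re)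
            (𝓝[>] 0) (𝓝 (inner ℂ (x - z) (((ω + 1 : ℝ) : ℂ) • (x - (z : H)))).re) :=
          (Complex.continuous_re.tendsto _).comp (tendsto_const_nhds.inner h2)
        refine le_of_tendsto h5 ?_
        filter_upwards [self_mem_nhdsWithin] with t (ht : 0 < t)
        rw [← Complex.coe_smul, inner_smul_right, Complex.re_ofReal_mul, inner_sub_right,
          Complex.sub_re]
        refine mul_nonpos_of_nonneg_of_nonpos (inv_nonneg.2 ht.le) ?_
        have h6 : (inner ℂ (x - (z : H)) (S t (x - z))).re ≤ ‖x - (z : H)‖ * ‖x - (z : H)‖ :=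
          (re_inner_le_norm (𝕜 := ℂ) _ _).trans
            (mul_le_mul_of_nonneg_left (hSc t ht.le _) (norm_nonneg _))
        have h7 : (inner ℂ (x - (z : H)) (x - z)).re = ‖x - (z : H)‖ * ‖x - (z : H)‖ :=
          inner_self_eq_norm_mul_norm (𝕜 := ℂ) _
        linarith
      rw [inner_smul_right, Complex.re_ofReal_mul,
        show (inner ℂ (x - (z : H)) (x - z)).re = ‖x - (z : H)‖ * ‖x - (z : H)‖ from
          inner_self_eq_norm_mul_norm (𝕜 := ℂ) _] at h4
      have h8 : x - (z : H) = 0 := by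
        rw [← norm_eq_zero, ← mul_self_eq_zero]
        refine le_antisymm ?_ (mul_self_nonneg _)
        exact nonpos_of_mul_nonpos_right h4 hω0
      rw [h8, smul_zero, sub_eq_zero] at h3
      rw [sub_eq_zero.1 h8, h3]
      exact A.mem_graph z

end Generation

/-! ### Strong continuity and contractivity -/

section Contraction

variable {H : Type*} [NormedAddCommGroup H] [InnerProductSpace ℂ H] {S : ℝ → H →L[ℂ] H}

theorem IsC0Semigroup.continuousWithinAt_zero (hS : IsC0Semigroup S) (x : H) :
    Tendsto (fun t => S t x) (𝓝[≥] 0) (𝓝 x) := by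
  have h : ContinuousWithinAt (fun t => S t x) (Set.Ioi 0) 0 := by
    rw [ContinuousWithinAt, hS.map_zero]
    exact hS.tendsto_zero x
  have h2 := continuousWithinAt_Ioi_iff_Ici.1 h
  rw [ContinuousWithinAt, hS.map_zero] at h2
  exact h2

/-- Otherwise there are times `t n → 0` with `‖S (t n)‖ > n`, although every orbit converges along
them; this contradicts uniform boundedness. -/
theorem IsC0Semigroup.exists_norm_le [CompleteSpace H] (hS : IsC0Semigroup S) :
    ∃ δ > 0, ∃ M : ℝ, 0 ≤ M ∧ ∀ t, 0 ≤ t → t < δ → ‖S t‖ ≤ M := by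
  by_contra hcon
  push Not at hcon
  choose! t ht0 ht1 ht2 using fun n : ℕ =>
    hcon (1 / ((n : ℝ) + 1)) (by positivity) n n.cast_nonneg
  have htend : Tendsto t atTop (𝓝[≥] 0) := by
    refine tendsto_nhdsWithin_iff.2 ⟨?_, Eventually.of_forall ht0⟩
    exact squeeze_zero ht0 (fun n => (ht1 n).le) tendsto_one_div_add_atTop_nhds_zero_nat
  obtain ⟨C, hC⟩ := banach_steinhaus (g := fun n => S (t n)) fun x => by
    obtain ⟨C, hC⟩ := (((hS.continuousWithinAt_zero x).comp htend).norm).bddAbove_range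
    exact ⟨C, fun n => hC ⟨n, rfl⟩⟩
  obtain ⟨n, hn⟩ := exists_nat_gt C
  exact absurd (hC n) (not_le.2 (hn.trans (ht2 n)))

theorem IsC0Semigroup.continuousOn [CompleteSpace H] (hS : IsC0Semigroup S) (x : H) :
    ContinuousOn (fun t => S t x) (Set.Ici 0) := by
  intro t (ht : 0 ≤ t)
  obtain ⟨δ, hδ, M, hM, hbd⟩ := hS.exists_norm_le
  -- The first summand serves `r ≥ t`. The second bounds `‖S r‖` for `r` slightly below `t`, by
  -- splitting `S r` at the base time `t - min (δ / 2) t`; the minimum keeps that time non-negative.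
  set K : ℝ := ‖S t‖ + ‖S (t - min (δ / 2) t)‖ * M with hK
  have hest : ∀ᶠ r in 𝓝[Set.Ici 0] t, ‖S r x - S t x‖ ≤ K * ‖S |r - t| x - x‖ := by
    have hnear : ∀ᶠ r in 𝓝 t, |r - t| < δ / 2 := by
      have := Metric.ball_mem_nhds t (show 0 < δ / 2 by positivity)
      filter_upwards [this] with r hr
      rwa [Metric.mem_ball, Real.dist_eq] at hr
    filter_upwards [hnear.filter_mono nhdsWithin_le_nhds, self_mem_nhdsWithin] with r hr (hr0 : 0 ≤ r)
    rcases le_or_gt t r with h | h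
    · have e : S r = (S t).comp (S (r - t)) := by
        rw [← hS.map_add t (r - t) ht (by linarith)]; congr 1; ring
      rw [abs_of_nonneg (by linarith), e, ContinuousLinearMap.comp_apply, ← map_sub]
      refine ((S t).le_opNorm _).trans (mul_le_mul_of_nonneg_right ?_ (norm_nonneg _))
      have : 0 ≤ ‖S (t - min (δ / 2) t)‖ * M := by positivity
      linarith
    · have e : S t = (S r).comp (S (t - r)) := by
        rw [← hS.map_add r (t - r) hr0 (by linarith)]; congr 1; ring
      rw [abs_of_neg (by linarith)] at hr ⊢
      have h1 : 0 ≤ t - min (δ / 2) t := by linarith [min_le_right (δ / 2) t]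
      have h2 : 0 ≤ r - (t - min (δ / 2) t) := by
        rcases min_choice (δ / 2) t with h | h <;> rw [h] <;> linarith
      have h3 : r - (t - min (δ / 2) t) < δ := by linarith [min_le_left (δ / 2) t]
      have e2 : S r = (S (t - min (δ / 2) t)).comp (S (r - (t - min (δ / 2) t))) := by
        rw [← hS.map_add _ _ h1 h2]; congr 1; ring
      have h4 : ‖S r‖ ≤ K := by
        rw [e2]
        refine (ContinuousLinearMap.opNorm_comp_le _ _).trans ?_
        have := mul_le_mul_of_nonneg_left (hbd _ h2 h3) (norm_nonneg (S (t - min (δ / 2) t)))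
        linarith [norm_nonneg (S t)]
      rw [neg_sub, norm_sub_rev, e, ContinuousLinearMap.comp_apply, ← map_sub]
      exact ((S r).le_opNorm _).trans (mul_le_mul_of_nonneg_right h4 (norm_nonneg _))
  have habs : Tendsto (fun r => |r - t|) (𝓝[Set.Ici 0] t) (𝓝[≥] 0) := by
    refine tendsto_nhdsWithin_iff.2 ⟨?_, Eventually.of_forall fun r => abs_nonneg (r - t)⟩
    have h : Continuous fun r => |r - t| := by fun_prop
    simpa using (h.tendsto t).mono_left nhdsWithin_le_nhds
  have hlim : Tendsto (fun r => K * ‖S |r - t| x - x‖) (𝓝[Set.Ici 0] t) (𝓝 0) := by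
    simpa using ((tendsto_iff_norm_sub_tendsto_zero.1
      (hS.continuousWithinAt_zero x)).comp habs).const_mul K
  rw [ContinuousWithinAt, tendsto_iff_norm_sub_tendsto_zero]
  exact squeeze_zero' (Eventually.of_forall fun _ => norm_nonneg _) hest hlim

theorem hasDerivWithinAt_Ici_of_tendsto {f : ℝ → H} {f' : H} {t : ℝ}
    (h : Tendsto (fun h : ℝ => h⁻¹ • (f (t + h) - f t)) (𝓝[>] 0) (𝓝 f')) :
    HasDerivWithinAt f f' (Set.Ici t) t := by
  rw [← hasDerivWithinAt_Ioi_iff_Ici, hasDerivWithinAt_iff_tendsto_slope' (by simp)]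
  have hsub : Tendsto (fun r => r - t) (𝓝[>] t) (𝓝[>] 0) := by
    refine tendsto_nhdsWithin_iff.2 ⟨?_, ?_⟩
    · have h : Continuous fun r => r - t := by fun_prop
      simpa using (h.tendsto t).mono_left nhdsWithin_le_nhds
    · filter_upwards [self_mem_nhdsWithin] with r (hr : t < r) using sub_pos.2 hr
  refine (h.comp hsub).congr fun r => ?_
  simp only [Function.comp, slope, vsub_eq_sub, add_sub_cancel]

theorem IsGeneratorOf.apply_mem {A : H →ₗ.[ℂ] H} (hA : IsGeneratorOf A S) (hS : IsC0Semigroup S)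
    {t : ℝ} (ht : 0 ≤ t) (x : A.domain) : (S t x, S t (A x)) ∈ A.graph := by
  rw [hA]
  have h := ((S t).continuous.tendsto _).comp ((hA x (A x)).1 (A.mem_graph x))
  refine h.congr' ?_
  filter_upwards [self_mem_nhdsWithin] with r (hr : 0 < r)
  rw [Function.comp, ContinuousLinearMap.map_smul_of_tower, map_sub,
    ← ContinuousLinearMap.comp_apply (S t), ← hS.map_add t r ht hr.le, add_comm,
    hS.map_add r t hr.le ht, ContinuousLinearMap.comp_apply]

/-- A strongly continuous semigroup of contractions. -/
structure IsContractionSemigroup (S : ℝ → H →L[ℂ] H) : Prop extends IsC0Semigroup S where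
  norm_le : ∀ t : ℝ, 0 ≤ t → ∀ x, ‖S t x‖ ≤ ‖x‖

/-- `semigroup A` is obtained by choice, so contractivity has to follow from the generator alone.
For `x` in the domain, `‖S t x‖²` has right derivative `2 Re ⟨S t x, A S t x⟩ ≤ 0`; density covers
the other `x`. -/
theorem IsC0Semigroup.isContractionSemigroup [CompleteSpace H] (hS : IsC0Semigroup S)
    {A : H →ₗ.[ℂ] H} (hA : IsGeneratorOf A S) (hd : Dense (A.domain : Set H))
    (hdiss : ∀ x : A.domain, (inner ℂ (x : H) (A x)).re ≤ 0) : IsContractionSemigroup S := by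
  refine ⟨hS, fun T hT x => ?_⟩
  have hcl : IsClosed {x : H | ‖S T x‖ ≤ ‖x‖} :=
    isClosed_le (S T).continuous.norm continuous_norm
  refine hd.induction (P := fun x => ‖S T x‖ ≤ ‖x‖) (fun x hx => ?_) hcl x
  have hder : ∀ t ∈ Set.Ico 0 T, HasDerivWithinAt (fun t => ‖S t x‖ ^ 2)
      (2 * (inner ℂ (S t x) (S t (A ⟨x, hx⟩))).re) (Set.Ici t) t := by
    intro t ht
    refine hasDerivWithinAt_norm_sq (hasDerivWithinAt_Ici_of_tendsto ?_)
    have h := ((S t).continuous.tendsto _).comp ((hA x (A ⟨x, hx⟩)).1 (A.mem_graph ⟨x, hx⟩))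
    refine h.congr' ?_
    filter_upwards [self_mem_nhdsWithin] with r (hr : 0 < r)
    rw [Function.comp, ContinuousLinearMap.map_smul_of_tower, map_sub,
      ← ContinuousLinearMap.comp_apply (S t), ← hS.map_add t r ht.1 hr.le]
  have hcont : ContinuousOn (fun t => ‖S t x‖ ^ 2) (Set.Icc 0 T) :=
    (((hS.continuousOn x).mono Set.Icc_subset_Ici_self).norm).pow 2
  have h := image_le_of_deriv_right_le_deriv_boundary hcont hder (B := fun _ => ‖x‖ ^ 2)
    (B' := fun _ => 0) (by rw [hS.map_zero]; rfl) continuousOn_const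
    (fun t _ => hasDerivWithinAt_const t _ _) (fun t ht => ?_) (Set.right_mem_Icc.2 hT)
  · exact le_of_sq_le_sq h (norm_nonneg _)
  · obtain ⟨y, hy1, hy2⟩ := (LinearPMap.mem_graph_iff A).1 (hA.apply_mem hS ht.1 ⟨x, hx⟩)
    have := hdiss y
    rw [hy1, hy2] at this
    simp only at this
    linarith

namespace IsContractionSemigroup

theorem norm_max_le (hS : IsContractionSemigroup S) (t : ℝ) (x : H) : ‖S (max t 0) x‖ ≤ ‖x‖ :=
  hS.norm_le _ (le_max_right _ _) x

/-- Contractions are equicontinuous, so strong continuity is joint continuity. This yields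
measurability of `s ↦ S (t - s) (f s)`. -/
theorem continuous_uncurry [CompleteSpace H] (hS : IsContractionSemigroup S) :
    Continuous fun p : ℝ × H => S (max p.1 0) p.2 := by
  rw [continuous_iff_continuousAt]
  rintro ⟨t, x⟩
  have h1 : Continuous fun r : ℝ => S (max r 0) x :=
    (hS.continuousOn x).comp_continuous (by fun_prop) fun r => le_max_right r 0
  have h2 : Tendsto (fun p : ℝ × H => ‖p.2 - x‖ + ‖S (max p.1 0) x - S (max t 0) x‖) (𝓝 (t, x))
      (𝓝 0) := by
    have : Continuous fun p : ℝ × H => ‖p.2 - x‖ + ‖S (max p.1 0) x - S (max t 0) x‖ :=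
      ((continuous_snd.sub continuous_const).norm).add
        (((h1.comp continuous_fst).sub continuous_const).norm)
    simpa using this.tendsto (t, x)
  rw [ContinuousAt, tendsto_iff_norm_sub_tendsto_zero]
  refine squeeze_zero (fun _ => norm_nonneg _) (fun p => ?_) h2
  have e : S (max p.1 0) p.2 - S (max t 0) x =
      S (max p.1 0) (p.2 - x) + (S (max p.1 0) x - S (max t 0) x) := by
    rw [map_sub]; abel
  rw [e]
  exact (norm_add_le _ _).trans (by gcongr; exact hS.norm_max_le _ _)

end IsContractionSemigroup

end Contraction

/-! ### Mild solutions: cocycle property, continuity, right derivative -/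

section Mild

variable {H : Type*} [NormedAddCommGroup H] [InnerProductSpace ℂ H] {S : ℝ → H →L[ℂ] H}

/-- The mild solution of `x' = A x + f`, `x(0) = x₀` for the semigroup `S` generated by `A`, with
`S` extended by the identity to negative times. -/
def mild (S : ℝ → H →L[ℂ] H) (x₀ : H) (f : ℝ → H) (t : ℝ) : H :=
  S (max t 0) x₀ + ∫ s in (0 : ℝ)..t, S (max (t - s) 0) (f s)

theorem mildSolution_eq_mild [CompleteSpace H] {m : ℕ} (A : H →ₗ.[ℂ] H)
    (B : EuclideanSpace ℂ (Fin m) →L[ℂ] H) (x₀ : H) (u : ℝ → EuclideanSpace ℂ (Fin m)) {t : ℝ}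
    (ht : 0 ≤ t) :
    mildSolution A B x₀ u t = mild (semigroup A) x₀ (fun s => B (u s)) t := by
  rw [mildSolution, mild, max_eq_left ht]
  congr 1
  refine intervalIntegral.integral_congr fun s hs => ?_
  rw [Set.uIcc_of_le ht] at hs
  rw [max_eq_left (by linarith [hs.2])]

theorem mild_congr {x₀ : H} {f g : ℝ → H} {t : ℝ}
    (h : ∀ᵐ s, s ∈ Set.uIoc 0 t → f s = g s) : mild S x₀ f t = mild S x₀ g t := by
  rw [mild, mild]
  congr 1
  refine intervalIntegral.integral_congr_ae ?_
  filter_upwards [h] with s hs hst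
  rw [hs hst]

theorem mild_at_zero (hS : IsContractionSemigroup S) (x₀ : H) (f : ℝ → H) :
    mild S x₀ f 0 = x₀ := by
  simp [mild, hS.map_zero]

theorem mild_zero_zero (t : ℝ) : mild S 0 (fun _ => 0) t = 0 := by
  simp [mild]

/-- The semigroup preserves the domain and commutes with `A` there. Apply the left inverse to `(l -
A) S t (G x) = S t x`. -/
theorem IsResolvent.apply_semigroup {A : H →ₗ.[ℂ] H} {l : ℝ} {G : H →L[ℂ] H}
    (hG : IsResolvent A l G) (hS : IsC0Semigroup S) (hA : IsGeneratorOf A S) {t : ℝ} (ht : 0 ≤ t)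
    (x : H) : G (S t x) = S t (G x) := by
  obtain ⟨y, hy1, hy2⟩ := (LinearPMap.mem_graph_iff A).1
    (hA.apply_mem hS ht ⟨G x, hG.mem x⟩)
  have h := hG.left_inv y
  simp only at hy1 hy2
  rw [hy1, hy2, ← map_smul, ← map_sub, hG.right_inv] at h
  exact h

namespace IsContractionSemigroup

theorem norm_integral_apply_le (hS : IsContractionSemigroup S) {f : ℝ → H} {t : ℝ} (ht : 0 ≤ t)
    (hf : IntervalIntegrable f volume 0 t) (r : ℝ) :
    ‖∫ s in (0 : ℝ)..t, S (max (r - s) 0) (f s)‖ ≤ ∫ s in (0 : ℝ)..t, ‖f s‖ :=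
  intervalIntegral.norm_integral_le_of_norm_le ht
    (Eventually.of_forall fun _ _ => hS.norm_max_le _ _) hf.norm

theorem norm_mild_le (hS : IsContractionSemigroup S) (x₀ : H) {f : ℝ → H} {t : ℝ} (ht : 0 ≤ t)
    (hf : IntervalIntegrable f volume 0 t) :
    ‖mild S x₀ f t‖ ≤ ‖x₀‖ + ∫ s in (0 : ℝ)..t, ‖f s‖ :=
  (norm_add_le _ _).trans (add_le_add (hS.norm_max_le _ _) (hS.norm_integral_apply_le ht hf t))

end IsContractionSemigroup

variable [CompleteSpace H]

namespace IsContractionSemigroup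

theorem intervalIntegrable_apply (hS : IsContractionSemigroup S) {f : ℝ → H} {a b : ℝ}
    (hf : IntervalIntegrable f volume a b) (t : ℝ) :
    IntervalIntegrable (fun s => S (max (t - s) 0) (f s)) volume a b := by
  rw [intervalIntegrable_iff] at hf ⊢
  refine Integrable.mono hf ?_ (Eventually.of_forall fun s => hS.norm_max_le _ _)
  exact hS.continuous_uncurry.comp_aestronglyMeasurable
    (((continuous_const.sub continuous_id).aestronglyMeasurable).prodMk hf.aestronglyMeasurable)

theorem norm_mild_sub_mild_le (hS : IsContractionSemigroup S) (x₀ : H) {f g : ℝ → H} {t : ℝ}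
    (ht : 0 ≤ t) (hf : IntervalIntegrable f volume 0 t) (hg : IntervalIntegrable g volume 0 t) :
    ‖mild S x₀ f t - mild S x₀ g t‖ ≤ ∫ s in (0 : ℝ)..t, ‖f s - g s‖ := by
  rw [mild, mild, add_sub_add_left_eq_sub,
    ← intervalIntegral.integral_sub (hS.intervalIntegrable_apply hf t)
      (hS.intervalIntegrable_apply hg t)]
  simp only [← map_sub]
  exact hS.norm_integral_apply_le ht (hf.sub hg) t

theorem mild_add (hS : IsContractionSemigroup S) (x₀ : H) {f : ℝ → H} {a t : ℝ} (ha : 0 ≤ a)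
    (ht : 0 ≤ t) (hf : IntervalIntegrable f volume 0 (a + t)) :
    mild S x₀ f (a + t) = mild S (mild S x₀ f a) (fun s => f (a + s)) t := by
  have hsub1 : Set.uIcc 0 a ⊆ Set.uIcc 0 (a + t) := by
    rw [Set.uIcc_of_le ha, Set.uIcc_of_le (by linarith)]
    exact Set.Icc_subset_Icc_right (by linarith)
  have hsub2 : Set.uIcc a (a + t) ⊆ Set.uIcc 0 (a + t) := by
    rw [Set.uIcc_of_le (by linarith), Set.uIcc_of_le (by linarith)]
    exact Set.Icc_subset_Icc_left ha
  have hfa := hf.mono_set hsub1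
  have hfb := hf.mono_set hsub2
  rw [mild, mild, mild, map_add, max_eq_left ha, max_eq_left ht, max_eq_left (add_nonneg ha ht),
    add_comm a t, hS.map_add t a ht ha, ContinuousLinearMap.comp_apply, add_assoc]
  congr 1
  rw [add_comm t a, ← intervalIntegral.integral_add_adjacent_intervals
    (hS.intervalIntegrable_apply hfa _) (hS.intervalIntegrable_apply hfb _),
    ← ContinuousLinearMap.intervalIntegral_comp_comm _ (hS.intervalIntegrable_apply hfa _)]
  congr 1
  · refine intervalIntegral.integral_congr fun s hs => ?_
    rw [Set.uIcc_of_le ha] at hs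
    rw [max_eq_left (by linarith [hs.2]), max_eq_left (by linarith [hs.2]),
      ← ContinuousLinearMap.comp_apply, ← hS.map_add t (a - s) ht (by linarith [hs.2])]
    congr 2
    ring
  · have h := intervalIntegral.integral_comp_add_left
      (fun s => S (max (a + t - s) 0) (f s)) (a := 0) (b := t) a
    rw [add_zero] at h
    rw [← h]
    refine intervalIntegral.integral_congr fun s _ => ?_
    simp only [add_sub_add_left_eq_sub]

/-- With the semigroup extended by the identity, the integrand on `[t, T]` is just `f`. The
convolution is thus an integral over the fixed interval `[0, T]`, continuous in `t` by domination,
minus a tail of the primitive of `f`. -/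
theorem continuousOn_mild (hS : IsContractionSemigroup S) (x₀ : H) {f : ℝ → H} {T : ℝ}
    (hf : IntervalIntegrable f volume 0 T) : ContinuousOn (mild S x₀ f) (Set.Icc 0 T) := by
  rcases lt_or_ge T 0 with hT | hT
  · rw [Set.Icc_eq_empty (not_le.2 hT)]; exact continuousOn_empty _
  have h1 : Continuous fun t : ℝ => S (max t 0) x₀ :=
    hS.continuous_uncurry.comp (continuous_id.prodMk continuous_const)
  have h2 : Continuous fun t : ℝ => ∫ s in (0 : ℝ)..T, S (max (t - s) 0) (f s) := by
    refine intervalIntegral.continuous_of_dominated_interval (bound := fun s => ‖f s‖)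
      (fun t => (intervalIntegrable_iff.1 (hS.intervalIntegrable_apply hf t)).aestronglyMeasurable)
      (fun t => Eventually.of_forall fun s _ => hS.norm_max_le _ _) hf.norm
      (Eventually.of_forall fun s _ => ?_)
    exact hS.continuous_uncurry.comp ((continuous_id.sub continuous_const).prodMk continuous_const)
  have h3 : ContinuousOn (fun t => ∫ s in (0 : ℝ)..t, f s) (Set.Icc 0 T) := by
    have := intervalIntegral.continuousOn_primitive_interval' hf (Set.left_mem_uIcc)
    rwa [Set.uIcc_of_le hT] at this
  have h4 : ContinuousOn (fun t => S (max t 0) x₀ + ((∫ s in (0 : ℝ)..T, S (max (t - s) 0) (f s)) -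
      ((∫ s in (0 : ℝ)..T, f s) - ∫ s in (0 : ℝ)..t, f s))) (Set.Icc 0 T) :=
    h1.continuousOn.add (h2.continuousOn.sub (continuousOn_const.sub h3))
  refine h4.congr fun t ht => ?_
  have hs1 : Set.uIcc 0 t ⊆ Set.uIcc 0 T := by
    rw [Set.uIcc_of_le hT, Set.uIcc_of_le ht.1]
    exact Set.Icc_subset_Icc_right ht.2
  have hs2 : Set.uIcc t T ⊆ Set.uIcc 0 T := by
    rw [Set.uIcc_of_le hT, Set.uIcc_of_le ht.2]
    exact Set.Icc_subset_Icc_left ht.1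
  have e1 := intervalIntegral.integral_add_adjacent_intervals
    (hS.intervalIntegrable_apply (hf.mono_set hs1) t)
    (hS.intervalIntegrable_apply (hf.mono_set hs2) t)
  have e2 := intervalIntegral.integral_add_adjacent_intervals (hf.mono_set hs1) (hf.mono_set hs2)
  have e3 : ∫ s in t..T, S (max (t - s) 0) (f s) = ∫ s in t..T, f s := by
    refine intervalIntegral.integral_congr fun s hs => ?_
    rw [Set.uIcc_of_le ht.2] at hs
    rw [max_eq_right (by linarith [hs.1]), hS.map_zero]
    rfl
  simp only [mild]
  rw [← e1, ← e2, e3]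
  abel

theorem map_mild (hS : IsContractionSemigroup S) {G : H →L[ℂ] H}
    (hG : ∀ t, 0 ≤ t → ∀ x, G (S t x) = S t (G x)) (x₀ : H) {f : ℝ → H} {t : ℝ}
    (hf : IntervalIntegrable f volume 0 t) :
    G (mild S x₀ f t) = mild S (G x₀) (fun s => G (f s)) t := by
  rw [mild, mild, map_add, hG _ (le_max_right _ _),
    ← ContinuousLinearMap.intervalIntegral_comp_comm _ (hS.intervalIntegrable_apply hf t)]
  simp only [hG _ (le_max_right _ _)]

theorem tendsto_slope_mild (hS : IsContractionSemigroup S) {A : H →ₗ.[ℂ] H}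
    (hA : IsGeneratorOf A S) (x : A.domain) {f : ℝ → H} (hf : Continuous f) :
    Tendsto (fun h : ℝ => h⁻¹ • (mild S x f h - x)) (𝓝[>] 0) (𝓝 (A x + f 0)) := by
  have h1 := (hA x (A x)).1 (A.mem_graph x)
  have h2 : Tendsto (fun h : ℝ => h⁻¹ • ∫ s in (0 : ℝ)..h, S (max (h - s) 0) (f s)) (𝓝[>] 0)
      (𝓝 (f 0)) := by
    rw [Metric.tendsto_nhds]
    intro ε hε
    have hc : Continuous fun p : ℝ × ℝ => S (max p.1 0) (f p.2) :=
      hS.continuous_uncurry.comp (continuous_fst.prodMk (hf.comp continuous_snd))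
    have h0 : S (max 0 0) (f 0) = f 0 := by rw [max_self, hS.map_zero]; rfl
    obtain ⟨δ, hδ, hball⟩ := Metric.continuousAt_iff.1 (hc.continuousAt (x := (0, 0))) (ε / 2)
      (by positivity)
    filter_upwards [Ioo_mem_nhdsGT hδ] with h hh
    have hintg : IntervalIntegrable (fun s => S (max (h - s) 0) (f s)) volume 0 h :=
      hS.intervalIntegrable_apply (hf.intervalIntegrable _ _) h
    have hbd : ‖∫ s in (0 : ℝ)..h, (S (max (h - s) 0) (f s) - f 0)‖ ≤ ε / 2 * |h - 0| := by
      refine intervalIntegral.norm_integral_le_of_norm_le_const fun s hs => ?_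
      rw [Set.uIoc_of_le hh.1.le] at hs
      have := hball (x := (h - s, s)) (by
        rw [Prod.dist_eq, max_lt_iff, Real.dist_eq, Real.dist_eq]
        constructor
        · simp only [sub_zero]; rw [abs_of_nonneg (by linarith [hs.2])]; linarith [hs.1, hh.2]
        · simp only [sub_zero]; rw [abs_of_nonneg hs.1.le]; linarith [hs.2, hh.2])
      rw [h0, dist_eq_norm] at this
      exact this.le
    rw [intervalIntegral.integral_sub hintg intervalIntegrable_const,
      intervalIntegral.integral_const, sub_zero, abs_of_pos hh.1] at hbd
    have e : (h⁻¹ • ∫ s in (0 : ℝ)..h, S (max (h - s) 0) (f s)) - f 0 =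
        h⁻¹ • ((∫ s in (0 : ℝ)..h, S (max (h - s) 0) (f s)) - h • f 0) := by
      rw [smul_sub, inv_smul_smul₀ hh.1.ne']
    rw [dist_eq_norm, e, norm_smul, norm_inv, Real.norm_of_nonneg hh.1.le, inv_mul_lt_iff₀ hh.1]
    have := mul_pos hh.1 hε
    linarith
  refine (h1.add h2).congr' ?_
  filter_upwards [self_mem_nhdsWithin] with h (hh : 0 < h)
  rw [← smul_add, mild, max_eq_left hh.le]
  congr 1
  abel

end IsContractionSemigroup

end Mild

/-! ### The energy inequality -/

section Energy

variable {H : Type*} [NormedAddCommGroup H] [InnerProductSpace ℂ H] {S : ℝ → H →L[ℂ] H}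

/-- The bound `2 (Re ⟨x, y⟩ - c dist(x, V)²)` for the growth of `‖x‖²` along `x' = A x + y`. -/
def growthRate (c : ℝ) (V : Submodule ℂ H) (x y : H) : ℝ :=
  2 * ((inner ℂ x y).re - c * Metric.infDist x V ^ 2)

theorem continuous_growthRate (c : ℝ) (V : Submodule ℂ H) :
    Continuous fun p : H × H => growthRate c V p.1 p.2 := by
  unfold growthRate
  have h1 : Continuous fun p : H × H => (inner ℂ p.1 p.2).re :=
    Complex.continuous_re.comp (continuous_fst.inner continuous_snd)
  have h2 : Continuous fun p : H × H => Metric.infDist p.1 (V : Set H) :=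
    (Metric.continuous_infDist_pt _).comp continuous_fst
  fun_prop

theorem infDist_le_norm (V : Submodule ℂ H) (x : H) : Metric.infDist x (V : Set H) ≤ ‖x‖ := by
  simpa using Metric.infDist_le_dist_of_mem (x := x) V.zero_mem

theorem abs_growthRate_le {c : ℝ} (hc : 0 ≤ c) (V : Submodule ℂ H) (x y : H) :
    |growthRate c V x y| ≤ 2 * (‖x‖ * ‖y‖ + c * ‖x‖ ^ 2) := by
  rw [growthRate, abs_mul, abs_two]
  have h1 : |(inner ℂ x y).re| ≤ ‖x‖ * ‖y‖ :=
    (Complex.abs_re_le_norm _).trans (norm_inner_le_norm _ _)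
  have h2 : |c * Metric.infDist x (V : Set H) ^ 2| ≤ c * ‖x‖ ^ 2 := by
    rw [abs_of_nonneg (by positivity)]
    exact mul_le_mul_of_nonneg_left
      (pow_le_pow_left₀ Metric.infDist_nonneg (infDist_le_norm V x) 2) hc
  have h3 := abs_sub (inner ℂ x y).re (c * Metric.infDist x (V : Set H) ^ 2)
  linarith

/-- The inner product is split bilinearly and the difference of squared distances is factored, the
distance being 1-Lipschitz. The estimate permits passing to the limit in the input. -/
theorem abs_growthRate_sub_le {c K : ℝ} (hc : 0 ≤ c) (V : Submodule ℂ H) {x x' : H} (y y' : H)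
    (hx : ‖x‖ ≤ K) (hx' : ‖x'‖ ≤ K) :
    |growthRate c V x y - growthRate c V x' y'| ≤
      2 * (K * ‖y - y'‖ + ‖x - x'‖ * ‖y'‖ + 2 * c * K * ‖x - x'‖) := by
  have e : growthRate c V x y - growthRate c V x' y' =
      2 * ((inner ℂ x (y - y')).re + (inner ℂ (x - x') y').re -
        c * ((Metric.infDist x V + Metric.infDist x' V) *
          (Metric.infDist x V - Metric.infDist x' V))) := by
    rw [growthRate, growthRate, inner_sub_right, inner_sub_left, Complex.sub_re, Complex.sub_re]
    ring
  have h1 : |(inner ℂ x (y - y')).re| ≤ K * ‖y - y'‖ :=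
    ((Complex.abs_re_le_norm _).trans (norm_inner_le_norm _ _)).trans
      (mul_le_mul_of_nonneg_right hx (norm_nonneg _))
  have h2 : |(inner ℂ (x - x') y').re| ≤ ‖x - x'‖ * ‖y'‖ :=
    (Complex.abs_re_le_norm _).trans (norm_inner_le_norm _ _)
  have h3 : |Metric.infDist x (V : Set H) - Metric.infDist x' V| ≤ ‖x - x'‖ := by
    have := (Metric.lipschitz_infDist_pt (V : Set H)).dist_le_mul x x'
    rwa [Real.dist_eq, dist_eq_norm, NNReal.coe_one, one_mul] at this
  have h4 : |Metric.infDist x (V : Set H) + Metric.infDist x' V| ≤ 2 * K := by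
    rw [abs_of_nonneg (add_nonneg Metric.infDist_nonneg Metric.infDist_nonneg)]
    linarith [infDist_le_norm V x, infDist_le_norm V x']
  have h5 : |c * ((Metric.infDist x (V : Set H) + Metric.infDist x' V) *
          (Metric.infDist x V - Metric.infDist x' V))| ≤ c * (2 * K * ‖x - x'‖) := by
    rw [abs_mul, abs_mul, abs_of_nonneg hc]
    exact mul_le_mul_of_nonneg_left (mul_le_mul h4 h3 (abs_nonneg _)
      ((abs_nonneg _).trans h4)) hc
  rw [e, abs_mul, abs_two]
  refine mul_le_mul_of_nonneg_left ?_ zero_le_two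
  have h6 := abs_sub ((inner ℂ x (y - y')).re + (inner ℂ (x - x') y').re)
    (c * ((Metric.infDist x (V : Set H) + Metric.infDist x' V) *
          (Metric.infDist x V - Metric.infDist x' V)))
  have h7 := abs_add_le (inner ℂ x (y - y')).re (inner ℂ (x - x') y').re
  linarith

theorem intervalIntegrable_growthRate {c : ℝ} (hc : 0 ≤ c) (V : Submodule ℂ H) {w f : ℝ → H}
    {T : ℝ} (hT : 0 ≤ T) (hw : ContinuousOn w (Set.Icc 0 T))
    (hf : IntervalIntegrable f volume 0 T) :
    IntervalIntegrable (fun t => growthRate c V (w t) (f t)) volume 0 T := by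
  obtain ⟨K, hK⟩ := isCompact_Icc.exists_bound_of_continuousOn hw
  have hb : IntervalIntegrable (fun t => 2 * (K * ‖f t‖ + c * K ^ 2)) volume 0 T :=
    ((hf.norm.const_mul K).add intervalIntegrable_const).const_mul 2
  rw [intervalIntegrable_iff_integrableOn_Ioc_of_le hT] at hf hb ⊢
  refine Integrable.mono' hb ?_ ?_
  · exact (continuous_growthRate c V).comp_aestronglyMeasurable
      (((hw.mono Set.Ioc_subset_Icc_self).aestronglyMeasurable measurableSet_Ioc).prodMk
        hf.aestronglyMeasurable)
  · refine (ae_restrict_mem measurableSet_Ioc).mono fun t ht => ?_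
    refine (abs_growthRate_le hc V _ _).trans ?_
    have := hK t (Set.Ioc_subset_Icc_self ht)
    gcongr

theorem exists_continuous_tendsto_integral {f : ℝ → H} {T : ℝ} (hT : 0 ≤ T)
    (hf : IntervalIntegrable f volume 0 T) :
    ∃ g : ℕ → ℝ → H, (∀ n, Continuous (g n)) ∧
      Tendsto (fun n => ∫ t in (0 : ℝ)..T, ‖g n t - f t‖) atTop (𝓝 0) ∧
      ∀ n, ∫ t in (0 : ℝ)..T, ‖g n t - f t‖ ≤ 1 := by
  rw [intervalIntegrable_iff_integrableOn_Ioc_of_le hT] at hf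
  choose g hg _ using fun n : ℕ =>
    Integrable.exists_boundedContinuous_integral_sub_le hf (show 0 < 1 / ((n : ℝ) + 1) by positivity)
  have hle : ∀ n, ∫ t in (0 : ℝ)..T, ‖g n t - f t‖ ≤ 1 / ((n : ℝ) + 1) := fun n => by
    rw [intervalIntegral.integral_of_le hT]
    simpa only [norm_sub_rev] using hg n
  refine ⟨fun n => g n, fun n => (g n).continuous, ?_, fun n => (hle n).trans ?_⟩
  · exact squeeze_zero (fun n => intervalIntegral.integral_nonneg hT fun _ _ => norm_nonneg _) hle
      tendsto_one_div_add_atTop_nhds_zero_nat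
  · rw [div_le_one (by positivity)]
    linarith [(n.cast_nonneg : (0 : ℝ) ≤ n)]

variable [CompleteSpace H]

/-- The energy inequality for solutions that are regularized by an operator `G` that commutes with
the semigroup and maps into the domain of the generator. -/
theorem IsContractionSemigroup.sq_norm_map_mild_le (hS : IsContractionSemigroup S)
    {A : H →ₗ.[ℂ] H} (hA : IsGeneratorOf A S) {c : ℝ} {V : Submodule ℂ H}
    (hV : ∀ x : A.domain, (inner ℂ (x : H) (A x)).re ≤ -(c * Metric.infDist (x : H) V ^ 2))
    {G : H →L[ℂ] H} (hG : ∀ t, 0 ≤ t → ∀ x, G (S t x) = S t (G x)) (hGA : ∀ x, G x ∈ A.domain)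
    (x₀ : H) {f : ℝ → H} (hf : Continuous f) {T : ℝ} (hT : 0 ≤ T) :
    ‖G (mild S x₀ f T)‖ ^ 2 ≤
      ‖G x₀‖ ^ 2 + ∫ t in (0 : ℝ)..T, growthRate c V (G (mild S x₀ f t)) (G (f t)) := by
  have hw : ContinuousOn (mild S x₀ f) (Set.Icc 0 T) :=
    hS.continuousOn_mild x₀ (hf.intervalIntegrable _ _)
  -- Clamping time to `[0, T]` makes the rate continuous on all of `ℝ`, so its primitive is
  -- differentiable everywhere.
  have hcl : Continuous fun t : ℝ => max 0 (min t T) := by fun_prop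
  have hmem : ∀ t : ℝ, max 0 (min t T) ∈ Set.Icc 0 T := fun t =>
    ⟨le_max_left _ _, max_le hT (min_le_right _ _)⟩
  have heq : ∀ t ∈ Set.Icc 0 T, max 0 (min t T) = t := fun t ht => by
    rw [min_eq_left ht.2, max_eq_right ht.1]
  set k : ℝ → ℝ := fun t => growthRate c V (G (mild S x₀ f (max 0 (min t T)))) (G (f t)) with hk
  have hkc : Continuous k := (continuous_growthRate c V).comp
    ((G.continuous.comp (hw.comp_continuous hcl hmem)).prodMk (G.continuous.comp hf))
  have hintg : ∫ t in (0 : ℝ)..T, growthRate c V (G (mild S x₀ f t)) (G (f t)) =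
      ∫ t in (0 : ℝ)..T, k t := by
    refine intervalIntegral.integral_congr fun t ht => ?_
    rw [Set.uIcc_of_le hT] at ht
    simp only [hk, heq t ht]
  rw [hintg]
  have hder : ∀ t ∈ Set.Ico 0 T, HasDerivWithinAt (fun t => ‖G (mild S x₀ f t)‖ ^ 2)
      (2 * (inner ℂ (G (mild S x₀ f t)) (A ⟨G (mild S x₀ f t), hGA _⟩ + G (f t))).re)
      (Set.Ici t) t := by
    intro t ht
    refine hasDerivWithinAt_norm_sq (f := fun t => G (mild S x₀ f t))
      (hasDerivWithinAt_Ici_of_tendsto ?_)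
    -- By the cocycle property the solution restarts at time `t` from `G (mild S x₀ f t)`, a vector
    -- of the domain, so the right derivative at zero suffices.
    have h := hS.tendsto_slope_mild hA ⟨G (mild S x₀ f t), hGA _⟩
      (f := fun s => G (f (t + s))) (G.continuous.comp (hf.comp (continuous_const_add t)))
    rw [add_zero] at h
    refine h.congr' ?_
    filter_upwards [self_mem_nhdsWithin] with h (hh : 0 < h)
    rw [hS.mild_add x₀ ht.1 hh.le (hf.intervalIntegrable _ _),
      hS.map_mild hG _ (f := fun s => f (t + s))
        ((hf.comp (continuous_const_add t)).intervalIntegrable _ _)]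
  have hcont : ContinuousOn (fun t => ‖G (mild S x₀ f t)‖ ^ 2) (Set.Icc 0 T) :=
    ((G.continuous.comp_continuousOn hw).norm).pow 2
  have hB : ∀ t, HasDerivAt (fun t => ‖G x₀‖ ^ 2 + ∫ s in (0 : ℝ)..t, k s) (k t) t := fun t =>
    (hkc.integral_hasStrictDerivAt 0 t).hasDerivAt.const_add _
  refine image_le_of_deriv_right_le_deriv_boundary hcont hder
    (B := fun t => ‖G x₀‖ ^ 2 + ∫ s in (0 : ℝ)..t, k s) (B' := k) ?_
    (fun t _ => (hB t).continuousAt.continuousWithinAt) (fun t _ => (hB t).hasDerivWithinAt)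
    (fun t ht => ?_) (Set.right_mem_Icc.2 hT)
  · rw [mild_at_zero hS, intervalIntegral.integral_same, add_zero]
  · simp only [hk, heq t (Set.Ico_subset_Icc_self ht)]
    rw [growthRate, inner_add_right, Complex.add_re]
    have := hV ⟨G (mild S x₀ f t), hGA _⟩
    simp only at this
    linarith

/-- The regularizers `l (l - A)⁻¹` are contractions, commute with the semigroup and tend strongly to
the identity. Dominated convergence removes them from the smoothed inequality. -/
theorem IsContractionSemigroup.sq_norm_mild_le_of_continuous (hS : IsContractionSemigroup S)
    {A : H →ₗ.[ℂ] H} {ω : ℝ} (hAm : IsMDissipative A ω) (hA : IsGeneratorOf A S) {c : ℝ}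
    (hc : 0 ≤ c) {V : Submodule ℂ H}
    (hV : ∀ x : A.domain, (inner ℂ (x : H) (A x)).re ≤ -(c * Metric.infDist (x : H) V ^ 2))
    (x₀ : H) {f : ℝ → H} (hf : Continuous f) {T : ℝ} (hT : 0 ≤ T) :
    ‖mild S x₀ f T‖ ^ 2 ≤
      ‖x₀‖ ^ 2 + ∫ t in (0 : ℝ)..T, growthRate c V (mild S x₀ f t) (f t) := by
  obtain ⟨G, hGS, hGA, hGn, hlim⟩ : ∃ G : ℕ → H →L[ℂ] H,
      (∀ n t, 0 ≤ t → ∀ x, G n (S t x) = S t (G n x)) ∧ (∀ n x, G n x ∈ A.domain) ∧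
      (∀ n x, ‖G n x‖ ≤ ‖x‖) ∧ ∀ x, Tendsto (fun n => G n x) atTop (𝓝 x) := by
    obtain ⟨l, G, hl, hl0, hG⟩ := hAm.exists_isResolvent_seq
    refine ⟨fun n => (l n : ℂ) • G n, fun n t ht x => ?_, fun n x =>
      A.domain.smul_mem _ ((hG n).mem x), fun n x => (hG n).norm_smul_le (hl0 n) x,
      tendsto_smul_resolvent hAm.dense hl hl0 hG⟩
    change (l n : ℂ) • G n (S t x) = S t ((l n : ℂ) • G n x)
    rw [(hG n).apply_semigroup hS.toIsC0Semigroup hA ht, map_smul]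
  have hw : ContinuousOn (mild S x₀ f) (Set.Icc 0 T) :=
    hS.continuousOn_mild x₀ (hf.intervalIntegrable _ _)
  have hrhs : Tendsto (fun n => ∫ t in (0 : ℝ)..T,
      growthRate c V (G n (mild S x₀ f t)) (G n (f t))) atTop
      (𝓝 (∫ t in (0 : ℝ)..T, growthRate c V (mild S x₀ f t) (f t))) := by
    refine intervalIntegral.tendsto_integral_filter_of_dominated_convergence
      (fun t => 2 * (‖mild S x₀ f t‖ * ‖f t‖ + c * ‖mild S x₀ f t‖ ^ 2))
      (Eventually.of_forall fun n => ?_) (Eventually.of_forall fun n => ?_) ?_ ?_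
    · have h := intervalIntegrable_growthRate hc V hT
        ((G n).continuous.comp_continuousOn hw)
        (((G n).continuous.comp hf).intervalIntegrable (μ := volume) 0 T)
      exact (intervalIntegrable_iff.1 h).aestronglyMeasurable
    · refine Eventually.of_forall fun t _ => (abs_growthRate_le hc V _ _).trans ?_
      have h1 := hGn n (mild S x₀ f t)
      have h2 := hGn n (f t)
      gcongr
    · refine ContinuousOn.intervalIntegrable ?_
      rw [Set.uIcc_of_le hT]
      exact continuousOn_const.mul ((hw.norm.mul hf.norm.continuousOn).add
        (continuousOn_const.mul (hw.norm.pow 2)))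
    · refine Eventually.of_forall fun t _ => ?_
      have h1 := (continuous_growthRate c V).tendsto (mild S x₀ f t, f t)
      have h2 : Tendsto (fun n => (G n (mild S x₀ f t), G n (f t))) atTop
          (𝓝 (mild S x₀ f t, f t)) := (hlim (mild S x₀ f t)).prodMk_nhds (hlim (f t))
      exact h1.comp h2
  exact le_of_tendsto_of_tendsto' ((hlim _).norm.pow 2) (((hlim x₀).norm.pow 2).add hrhs)
    fun n => hS.sq_norm_map_mild_le hA hV (hGS n) (hGA n) x₀ hf hT

/-- The energy inequality for mild solutions. -/
theorem IsContractionSemigroup.sq_norm_mild_le (hS : IsContractionSemigroup S)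
    {A : H →ₗ.[ℂ] H} {ω : ℝ} (hAm : IsMDissipative A ω) (hA : IsGeneratorOf A S) {c : ℝ}
    (hc : 0 ≤ c) {V : Submodule ℂ H}
    (hV : ∀ x : A.domain, (inner ℂ (x : H) (A x)).re ≤ -(c * Metric.infDist (x : H) V ^ 2))
    (x₀ : H) {f : ℝ → H} {T : ℝ} (hT : 0 ≤ T) (hf : IntervalIntegrable f volume 0 T) :
    ‖mild S x₀ f T‖ ^ 2 ≤
      ‖x₀‖ ^ 2 + ∫ t in (0 : ℝ)..T, growthRate c V (mild S x₀ f t) (f t) := by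
  obtain ⟨g, hg, hgf, hg1⟩ := exists_continuous_tendsto_integral hT hf
  set ε : ℕ → ℝ := fun n => ∫ t in (0 : ℝ)..T, ‖g n t - f t‖ with hε
  have hgi : ∀ n, IntervalIntegrable (g n) volume 0 T := fun n => (hg n).intervalIntegrable _ _
  have hsub : ∀ t ∈ Set.Icc 0 T, Set.uIcc 0 t ⊆ Set.uIcc 0 T := fun t ht => by
    rw [Set.uIcc_of_le hT, Set.uIcc_of_le ht.1]
    exact Set.Icc_subset_Icc_right ht.2
  have hmono : ∀ h : ℝ → H, IntervalIntegrable h volume 0 T → ∀ t ∈ Set.Icc 0 T,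
      ∫ s in (0 : ℝ)..t, ‖h s‖ ≤ ∫ s in (0 : ℝ)..T, ‖h s‖ := fun h hh t ht =>
    intervalIntegral.integral_mono_interval le_rfl ht.1 ht.2
      (Eventually.of_forall fun _ => norm_nonneg _) hh.norm
  have hdiff : ∀ n, ∀ t ∈ Set.Icc 0 T, ‖mild S x₀ (g n) t - mild S x₀ f t‖ ≤ ε n := fun n t ht =>
    (hS.norm_mild_sub_mild_le x₀ ht.1 ((hgi n).mono_set (hsub t ht))
      (hf.mono_set (hsub t ht))).trans (hmono _ ((hgi n).sub hf) t ht)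
  -- A common bound for all trajectories involved; the `+ 1` absorbs the approximation error `ε n ≤
  -- 1`.
  set K : ℝ := ‖x₀‖ + (∫ t in (0 : ℝ)..T, ‖f t‖) + 1 with hK
  have hwK : ∀ t ∈ Set.Icc 0 T, ‖mild S x₀ f t‖ ≤ K - 1 := fun t ht => by
    have h1 := hS.norm_mild_le x₀ ht.1 (hf.mono_set (hsub t ht))
    have h2 := hmono f hf t ht
    linarith
  have hwK' : ∀ n, ∀ t ∈ Set.Icc 0 T, ‖mild S x₀ (g n) t‖ ≤ K := fun n t ht => by
    have h1 := norm_le_norm_add_norm_sub' (mild S x₀ (g n) t) (mild S x₀ f t)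
    linarith [hdiff n t ht, hwK t ht, hg1 n]
  have hT' : T ∈ Set.Icc 0 T := Set.right_mem_Icc.2 hT
  have hlhs : Tendsto (fun n => ‖mild S x₀ (g n) T‖ ^ 2) atTop (𝓝 (‖mild S x₀ f T‖ ^ 2)) := by
    refine Tendsto.pow (Tendsto.norm ?_) 2
    rw [tendsto_iff_norm_sub_tendsto_zero]
    exact squeeze_zero (fun _ => norm_nonneg _) (fun n => hdiff n T hT') hgf
  have hrhs : Tendsto (fun n => ∫ t in (0 : ℝ)..T, growthRate c V (mild S x₀ (g n) t) (g n t)) atTop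
      (𝓝 (∫ t in (0 : ℝ)..T, growthRate c V (mild S x₀ f t) (f t))) := by
    rw [tendsto_iff_norm_sub_tendsto_zero]
    have hlim : Tendsto (fun n => 2 * (K * ε n + ε n * (∫ t in (0 : ℝ)..T, ‖f t‖) +
        2 * c * K * ε n * T)) atTop (𝓝 0) := by
      have : Tendsto (fun n => 2 * (K * ε n + ε n * (∫ t in (0 : ℝ)..T, ‖f t‖) +
        2 * c * K * ε n * T)) atTop (𝓝 (2 * (K * 0 + 0 * (∫ t in (0 : ℝ)..T, ‖f t‖) +
        2 * c * K * 0 * T))) :=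
        (((hgf.const_mul K).add (hgf.mul_const _)).add
          ((hgf.const_mul (2 * c * K)).mul_const T)).const_mul 2
      simpa using this
    refine squeeze_zero (fun _ => norm_nonneg _) (fun n => ?_) hlim
    rw [← intervalIntegral.integral_sub
      (intervalIntegrable_growthRate hc V hT (hS.continuousOn_mild x₀ (hgi n)) (hgi n))
      (intervalIntegrable_growthRate hc V hT (hS.continuousOn_mild x₀ hf) hf)]
    have hi1 : IntervalIntegrable (fun t => K * ‖g n t - f t‖) volume 0 T :=
      ((hgi n).sub hf).norm.const_mul K
    have hi2 : IntervalIntegrable (fun t => ε n * ‖f t‖) volume 0 T := hf.norm.const_mul _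
    have hbound : ∫ t in (0 : ℝ)..T, 2 * (K * ‖g n t - f t‖ + ε n * ‖f t‖ + 2 * c * K * ε n) =
        2 * (K * ε n + ε n * (∫ t in (0 : ℝ)..T, ‖f t‖) + 2 * c * K * ε n * T) := by
      rw [intervalIntegral.integral_const_mul, intervalIntegral.integral_add (hi1.add hi2)
        intervalIntegrable_const, intervalIntegral.integral_add hi1 hi2,
        intervalIntegral.integral_const_mul, intervalIntegral.integral_const_mul,
        intervalIntegral.integral_const, smul_eq_mul]
      ring
    rw [← hbound]
    refine intervalIntegral.norm_integral_le_of_norm_le hT (Eventually.of_forall fun t ht => ?_)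
      (((hi1.add hi2).add intervalIntegrable_const).const_mul 2)
    have ht' := Set.Ioc_subset_Icc_self ht
    have hK0 : 0 ≤ K := (norm_nonneg _).trans (hwK' n t ht')
    refine (abs_growthRate_sub_le hc V (g n t) (f t) (hwK' n t ht')
      ((hwK t ht').trans (by linarith))).trans ?_
    have := hdiff n t ht'
    gcongr
  exact le_of_tendsto_of_tendsto' hlhs (tendsto_const_nhds.add hrhs) fun n =>
    hS.sq_norm_mild_le_of_continuous hAm hA hc hV x₀ (hg n) hT

end Energy

/-! ### The spectral gap of `R`, seen through `(1 + R)⁻¹` -/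

section Gap

variable {H : Type*} [NormedAddCommGroup H] [InnerProductSpace ℂ H]

/-- Here `G = (1 + R)⁻¹` and `μ - G = μ (R - s) G` with `s = μ⁻¹ - 1`. For `T = (R - s)⁻¹` the
inverse is `μ⁻¹ (1 + R) T`, and `(1 + R) T = 1 + μ⁻¹ T` is bounded. -/
theorem notMem_spectrum_of_mem_resolventSet {R : H →ₗ.[ℂ] H} {G : H →L[ℂ] H}
    (hG : ∀ y, ∃ hy : G y ∈ R.domain, G y + R ⟨G y, hy⟩ = y)
    (hG' : ∀ x : R.domain, G (x + R x) = x) {μ : ℝ} (hμ : μ ≠ 0)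
    (hs : ((μ : ℂ)⁻¹ - 1) ∈ resolventSet R) : μ ∉ _root_.spectrum ℝ G := by
  obtain ⟨T, hT, hT'⟩ := hs
  have hμ' : (μ : ℂ) ≠ 0 := Complex.ofReal_ne_zero.2 hμ
  rw [spectrum.notMem_iff, isUnit_iff_exists]
  have halg : ∀ y, (algebraMap ℝ (H →L[ℂ] H) μ - G) y = (μ : ℂ) • y - G y := fun y => by
    rw [Complex.coe_smul]; rfl
  refine ⟨(μ : ℂ)⁻¹ • (1 + (μ : ℂ)⁻¹ • T), ?_, ?_⟩
  · ext y
    change (algebraMap ℝ (H →L[ℂ] H) μ - G) ((μ : ℂ)⁻¹ • (y + (μ : ℂ)⁻¹ • T y)) = y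
    obtain ⟨hy, hTy⟩ := hT y
    have h1 : y + (μ : ℂ)⁻¹ • T y = T y + R ⟨T y, hy⟩ := by
      nth_rewrite 1 [← hTy]
      rw [sub_smul, one_smul]
      abel
    have h2 := hG' ⟨T y, hy⟩
    simp only at h2
    rw [halg, smul_inv_smul₀ hμ', map_smul, h1, h2, ← h1, add_sub_cancel_right]
  · ext y
    change (μ : ℂ)⁻¹ • ((algebraMap ℝ (H →L[ℂ] H) μ - G) y +
      (μ : ℂ)⁻¹ • T ((algebraMap ℝ (H →L[ℂ] H) μ - G) y)) = y
    obtain ⟨hy, hGy⟩ := hG y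
    have h1 : (μ : ℂ) • y - G y =
        (μ : ℂ) • (R ⟨G y, hy⟩ - ((μ : ℂ)⁻¹ - 1) • G y) := by
      rw [sub_smul, one_smul, smul_sub, smul_sub, smul_inv_smul₀ hμ']
      nth_rewrite 1 [← hGy]
      rw [smul_add]
      abel
    have h2 := hT' ⟨G y, hy⟩
    simp only at h2
    have h3 : T ((μ : ℂ) • y - G y) = (μ : ℂ) • G y := by rw [h1, map_smul, h2]
    rw [halg, h3, inv_smul_smul₀ hμ', sub_add_cancel, inv_smul_smul₀ hμ']

variable [CompleteSpace H]

theorem IsNonneg.exists_inverse_one_add {R : H →ₗ.[ℂ] H} (hR : IsSelfAdjoint R)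
    (hR0 : IsNonneg R) : ∃ G : H →L[ℂ] H, IsSelfAdjoint G ∧ 0 ≤ G ∧ ‖G‖ ≤ 1 ∧
      (∀ y, ∃ hy : G y ∈ R.domain, G y + R ⟨G y, hy⟩ = y) ∧
      ∀ x : R.domain, G (x + R x) = x := by
  obtain ⟨S, hS, hS'⟩ := exists_resolvent_of_accretive hR0 one_pos
    fun y => hR0.exists_smul_add_eq hR one_pos y
  have hSn : ∀ y, 1 * ‖(S y : H)‖ ≤ ‖y‖ := fun y => by
    simpa only [hS] using mul_norm_le_of_re_inner_nonneg (hR0 (S y)) zero_le_one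
  simp only [Complex.ofReal_one, one_smul, one_mul] at hS hS' hSn
  have hsymm : ∀ x y : R.domain, inner ℂ (R x) (y : H) = inner ℂ (x : H) (R y) := by
    have h := LinearPMap.adjoint_isFormalAdjoint hR.dense_domain
    rwa [LinearPMap.isSelfAdjoint_def.1 hR] at h
  set G : H →L[ℂ] H := (R.domain.subtype ∘ₗ S).mkContinuous 1
    fun y => by rw [one_mul]; exact hSn y with hG
  have hGS : ∀ y, G y = S y := fun y => rfl
  have hsa : IsSelfAdjoint G := by
    rw [ContinuousLinearMap.isSelfAdjoint_iff_isSymmetric]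
    intro x y
    change inner ℂ (G x) y = inner ℂ x (G y)
    rw [hGS, hGS]
    nth_rewrite 1 [← hS y]
    nth_rewrite 2 [← hS x]
    rw [inner_add_right, inner_add_left, hsymm]
  refine ⟨G, hsa, ?_, LinearMap.mkContinuous_norm_le _ zero_le_one _, fun y => ⟨(S y).2, hS y⟩,
    fun x => congrArg Subtype.val (hS' x)⟩
  rw [ContinuousLinearMap.nonneg_iff_isPositive, ContinuousLinearMap.isPositive_def']
  refine ⟨hsa, fun x => ?_⟩
  rw [ContinuousLinearMap.reApplyInnerSelf_apply, hGS]
  nth_rewrite 2 [← hS x]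
  rw [inner_add_right, map_add]
  exact add_nonneg inner_self_nonneg (hR0 (S x))

/-- The map `μ ↦ μ⁻¹ - 1` carries punctured neighbourhoods of `1` into punctured neighbourhoods of
`0`. If `0` is in the resolvent set, `1` itself is outside the closed spectrum of `G`. -/
theorem eventually_notMem_spectrum {R : H →ₗ.[ℂ] H} {G : H →L[ℂ] H}
    (hG : ∀ y, ∃ hy : G y ∈ R.domain, G y + R ⟨G y, hy⟩ = y)
    (hG' : ∀ x : R.domain, G (x + R x) = x)
    (hspec : (0 : ℂ) ∈ discreteSpectrum R ∪ resolventSet R) :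
    ∀ᶠ μ in 𝓝[≠] (1 : ℝ), μ ∉ _root_.spectrum ℝ G := by
  rcases hspec with ⟨-, h⟩ | h
  · have hc : ContinuousAt (fun μ : ℝ => (μ : ℂ)⁻¹ - 1) 1 :=
      (Complex.continuous_ofReal.continuousAt.inv₀ (by simp)).sub continuousAt_const
    have ht : Tendsto (fun μ : ℝ => (μ : ℂ)⁻¹ - 1) (𝓝[≠] 1) (𝓝[≠] 0) := by
      refine tendsto_nhdsWithin_iff.2 ⟨?_, ?_⟩
      · have := hc.tendsto
        simp only [Complex.ofReal_one, inv_one, sub_self] at this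
        exact this.mono_left nhdsWithin_le_nhds
      · filter_upwards [self_mem_nhdsWithin] with μ hμ h0
        refine hμ ?_
        rw [Set.mem_singleton_iff, sub_eq_zero, inv_eq_one] at h0
        exact_mod_cast h0
    have hne : ∀ᶠ μ : ℝ in 𝓝[≠] 1, μ ≠ 0 :=
      (isOpen_ne.mem_nhds one_ne_zero : {μ : ℝ | μ ≠ 0} ∈ 𝓝 1) |> mem_nhdsWithin_of_mem_nhds
    filter_upwards [ht.eventually h, hne] with μ h1 h2
    exact notMem_spectrum_of_mem_resolventSet hG hG' h2 (not_not.1 h1)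
  · have h1 : (1 : ℝ) ∉ _root_.spectrum ℝ G :=
      notMem_spectrum_of_mem_resolventSet hG hG' one_ne_zero (by simpa using h)
    exact mem_nhdsWithin_of_mem_nhds ((_root_.spectrum.isClosed G).isOpen_compl.mem_nhds h1)

/-- For a self-adjoint `G` with spectrum in `[0, 1 - ε] ∪ {1}`, the part `E` of `G` that belongs to
`[0, 1 - ε]`. -/
theorem exists_spectral_part {G : H →L[ℂ] H} (hsa : IsSelfAdjoint G) {ε : ℝ} (hε : 0 < ε)
    (hσ : ∀ μ ∈ _root_.spectrum ℝ G, 0 ≤ μ ∧ (μ = 1 ∨ μ ≤ 1 - ε)) :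
    ∃ E : H →L[ℂ] H, IsSelfAdjoint E ∧ ε • (E * E) ≤ G - G * G ∧ (1 - G) * (G - E) = 0 := by
  -- A continuous cutoff: it is the identity up to `1 - ε`, vanishes at `1`, and its values in
  -- between do not matter, as the spectrum has no points there.
  set h : ℝ → ℝ := fun μ => μ * min 1 ((1 - μ) / ε) with hh
  have hcont : Continuous h := by fun_prop
  have hval : ∀ μ ∈ _root_.spectrum ℝ G, (μ = 1 ∧ h μ = 0) ∨ (μ ≤ 1 - ε ∧ h μ = μ) := by
    intro μ hμ
    rcases (hσ μ hμ).2 with h1 | h1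
    · exact Or.inl ⟨h1, by simp [hh, h1]⟩
    · refine Or.inr ⟨h1, ?_⟩
      have : 1 ≤ (1 - μ) / ε := by rw [le_div_iff₀ hε]; linarith
      simp [hh, min_eq_left this]
  have hle : ε • (cfc h G * cfc h G) ≤ G - G * G := by
    have h1 : cfc (fun μ => ε • (h μ * h μ)) G ≤ cfc (fun μ : ℝ => μ - μ * μ) G := by
      refine cfc_mono fun μ hμ => ?_
      have h0 := (hσ μ hμ).1
      rcases hval μ hμ with ⟨h1, h2⟩ | ⟨h1, h2⟩
      · rw [h2, h1]; simp
      · rw [h2, smul_eq_mul]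
        nlinarith [mul_nonneg h0 (show 0 ≤ 1 - ε - μ by linarith),
          mul_nonneg hε.le (mul_nonneg h0 (show 0 ≤ 1 - μ by linarith))]
    rw [cfc_smul ε (fun μ => h μ * h μ) G, cfc_mul h h G,
      cfc_sub (fun μ => μ) (fun μ => μ * μ) G, cfc_mul (fun μ => μ) (fun μ => μ) G,
      cfc_id' ℝ G] at h1
    exact h1
  have hker : (1 - G) * (G - cfc h G) = 0 := by
    have h1 : cfc (fun μ => (1 - μ) * (μ - h μ)) G = 0 := by
      rw [← cfc_zero ℝ G]
      refine cfc_congr fun μ hμ => ?_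
      rcases hval μ hμ with ⟨h1, h2⟩ | ⟨h1, h2⟩
      · simp [h1]
      · simp [h2]
    rw [cfc_mul (fun μ => 1 - μ) (fun μ => μ - h μ) G, cfc_sub (fun _ => 1) (fun μ => μ) G,
      cfc_sub (fun μ => μ) h G, cfc_id' ℝ G, cfc_const_one ℝ G] at h1
    exact h1
  exact ⟨cfc h G, cfc_predicate h G, hle, hker⟩

/-- The spectral gap of `R` above zero as a lower bound for its quadratic form. -/
theorem IsNonneg.exists_mul_infDist_sq_le {R : H →ₗ.[ℂ] H} (hR : IsSelfAdjoint R)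
    (hR0 : IsNonneg R) (hspec : (0 : ℂ) ∈ discreteSpectrum R ∪ resolventSet R) :
    ∃ c : ℝ, 0 < c ∧ ∀ x : R.domain,
      c * Metric.infDist (x : H) (kernel R : Set H) ^ 2 ≤ (inner ℂ (x : H) (R x)).re := by
  obtain ⟨G, hsa, hpos, hnorm, hG, hG'⟩ := hR0.exists_inverse_one_add hR
  obtain ⟨ε, hε, hball⟩ := Metric.mem_nhdsWithin_iff.1 (eventually_notMem_spectrum hG hG' hspec)
  have hσ : ∀ μ ∈ _root_.spectrum ℝ G, 0 ≤ μ ∧ (μ = 1 ∨ μ ≤ 1 - ε) := by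
    intro μ hμ
    have h0 : 0 ≤ μ := spectrum_nonneg_of_nonneg hpos hμ
    refine ⟨h0, or_iff_not_imp_left.2 fun h1 => ?_⟩
    have hle : μ ≤ 1 := by
      have h2 := spectrum.norm_le_norm_mul_of_mem hμ
      have h3 : ‖(1 : H →L[ℂ] H)‖ ≤ 1 := ContinuousLinearMap.norm_id_le
      have h4 : ‖G‖ * ‖(1 : H →L[ℂ] H)‖ ≤ 1 := mul_le_one₀ hnorm (norm_nonneg _) h3
      exact (le_abs_self μ).trans (h2.trans h4)
    by_contra hcon
    push Not at hcon
    refine hball ⟨?_, h1⟩ hμ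
    rw [Metric.mem_ball, Real.dist_eq, abs_of_nonpos (by linarith)]
    linarith
  obtain ⟨E, hE, hle, hker⟩ := exists_spectral_part hsa hε hσ
  refine ⟨ε, hε, fun x => ?_⟩
  -- For this `y` one has `G y = x` and `(G - G²) y = G (R x)`, so `⟨y, (G - G²) y⟩ = ⟨x, R x⟩`.
  set y : H := x + R x with hy
  have hGy : G y = x := hG' x
  have hdist : Metric.infDist (x : H) (kernel R : Set H) ≤ ‖E y‖ := by
    -- The relation `(1 - G)(G - E) = 0` makes `v` a fixed vector of `G`, which means `R v = 0`. Its
    -- distance to `x` is `‖E y‖`.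
    set v : H := G y - E y with hv
    have h1 : v - G v = 0 := congrArg (fun T : H →L[ℂ] H => T y) hker
    obtain ⟨hm, h2⟩ := hG v
    have h3 : R ⟨G v, hm⟩ = 0 := (eq_sub_of_add_eq' h2).trans h1
    have h4 : v ∈ kernel R := ⟨⟨G v, hm⟩, h3, (sub_eq_zero.1 h1).symm⟩
    have h5 := Metric.infDist_le_dist_of_mem (x := (x : H)) h4
    rwa [dist_eq_norm, hv, hGy, sub_sub_cancel] at h5
  have hquad : ε * ‖E y‖ ^ 2 ≤ (inner ℂ (x : H) (R x)).re := by
    have h1 := ((ContinuousLinearMap.le_def _ _).1 hle).re_inner_nonneg_right y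
    have e : (G - G * G - ε • (E * E)) y =
        G (R x) - (ε : ℂ) • E (E y) := by
      have e1 : (G - G * G - ε • (E * E)) y =
        G y - G (G y) - ε • E (E y) := rfl
      rw [e1, ← map_sub, hGy, hy, add_sub_cancel_left, Complex.coe_smul]
    have e2 : inner ℂ y (G (R x)) = inner ℂ (x : H) (R x) := by
      rw [← hGy]
      exact ((ContinuousLinearMap.isSelfAdjoint_iff_isSymmetric.1 hsa) y (R x)).symm
    have e3 : inner ℂ y (E (E y)) = inner ℂ (E y) (E y) :=
      ((ContinuousLinearMap.isSelfAdjoint_iff_isSymmetric.1 hE) y (E y)).symm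
    have e4 : (inner ℂ (E y) (E y)).re = ‖E y‖ ^ 2 :=
      inner_self_eq_norm_sq (𝕜 := ℂ) _
    rw [e, inner_sub_right, inner_smul_right, e2, e3] at h1
    have h2 : 0 ≤ (inner ℂ (x : H) (R x) - (ε : ℂ) * inner ℂ (E y) (E y)).re := h1
    rw [Complex.sub_re, Complex.re_ofReal_mul, e4] at h2
    linarith
  refine le_trans ?_ hquad
  exact mul_le_mul_of_nonneg_left (pow_le_pow_left₀ Metric.infDist_nonneg hdist 2) hε.le

end Gap

/-! ### Supplied energy -/

section Supply

variable {H : Type*} [NormedAddCommGroup H] [InnerProductSpace ℂ H] {S : ℝ → H →L[ℂ] H}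

/-- The energy `∫₀ᵀ Re ⟨x(t), f(t)⟩ dt` that is supplied along the mild solution of
`x' = A x + f`. -/
def supply (S : ℝ → H →L[ℂ] H) (x₀ : H) (f : ℝ → H) (T : ℝ) : ℝ :=
  ∫ t in (0 : ℝ)..T, (inner ℂ (mild S x₀ f t) (f t)).re

theorem mild_congr_of_eqOn {x₀ : H} {f g : ℝ → H} {T : ℝ} (h : Set.EqOn f g (Set.Ioc 0 T)) {t : ℝ}
    (ht : t ∈ Set.Icc 0 T) : mild S x₀ f t = mild S x₀ g t := by
  refine mild_congr (Eventually.of_forall fun s hs => ?_)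
  rw [Set.uIoc_of_le ht.1] at hs
  exact h ⟨hs.1, hs.2.trans ht.2⟩

theorem supply_congr {x₀ : H} {f g : ℝ → H} {T : ℝ} (hT : 0 ≤ T)
    (h : Set.EqOn f g (Set.Ioc 0 T)) : supply S x₀ f T = supply S x₀ g T := by
  rw [supply, supply]
  refine intervalIntegral.integral_congr_ae (Eventually.of_forall fun t ht => ?_)
  rw [Set.uIoc_of_le hT] at ht
  rw [mild_congr_of_eqOn h (Set.Ioc_subset_Icc_self ht), h ht]

theorem supply_zero_zero (T : ℝ) : supply S 0 (fun _ => 0) T = 0 := by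
  simp [supply]

theorem IsContractionSemigroup.supply_le (hS : IsContractionSemigroup S) (x₀ : H) {f : ℝ → H}
    {T b : ℝ} (hT : 0 ≤ T) (hb : 0 ≤ b) (hf : IntervalIntegrable f volume 0 T)
    (hfb : ∀ᵐ t, t ∈ Set.Icc 0 T → ‖f t‖ ≤ b) :
    supply S x₀ f T ≤ (‖x₀‖ + b * T) * b * T := by
  have hintg : ∀ t ∈ Set.Icc 0 T, ∫ s in (0 : ℝ)..t, ‖f s‖ ≤ b * T := fun t ht => by
    have h1 : ‖∫ s in (0 : ℝ)..t, ‖f s‖‖ ≤ b * |t - 0| := by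
      refine intervalIntegral.norm_integral_le_of_norm_le_const_ae ?_
      filter_upwards [hfb] with s hs hst
      rw [Set.uIoc_of_le ht.1] at hst
      rw [norm_norm]
      exact hs ⟨hst.1.le, hst.2.trans ht.2⟩
    rw [sub_zero, abs_of_nonneg ht.1] at h1
    exact (le_abs_self _).trans (h1.trans (mul_le_mul_of_nonneg_left ht.2 hb))
  have h : ‖supply S x₀ f T‖ ≤ (‖x₀‖ + b * T) * b * |T - 0| := by
    refine intervalIntegral.norm_integral_le_of_norm_le_const_ae ?_
    filter_upwards [hfb] with t hft ht
    rw [Set.uIoc_of_le hT] at ht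
    have ht' := Set.Ioc_subset_Icc_self ht
    have hsub : Set.uIcc 0 t ⊆ Set.uIcc 0 T := by
      rw [Set.uIcc_of_le hT, Set.uIcc_of_le ht'.1]
      exact Set.Icc_subset_Icc_right ht'.2
    refine ((Complex.abs_re_le_norm _).trans (norm_inner_le_norm _ _)).trans ?_
    have h1 := hS.norm_mild_le x₀ ht'.1 (hf.mono_set hsub)
    have h2 := hintg t ht'
    exact mul_le_mul (by linarith) (hft ht') (norm_nonneg _) (by positivity)
  rw [sub_zero, abs_of_nonneg hT] at h
  exact (le_abs_self _).trans h

theorem growthRate_zero (V : Submodule ℂ H) (x y : H) :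
    growthRate 0 V x y = 2 * (inner ℂ x y).re := by
  rw [growthRate, zero_mul, sub_zero]

variable [CompleteSpace H]

/-- This is the growth rate with `c = 0`, up to the factor two. -/
theorem IsContractionSemigroup.intervalIntegrable_re_inner (hS : IsContractionSemigroup S) (x₀ : H)
    {f : ℝ → H} {T : ℝ} (hT : 0 ≤ T) (hf : IntervalIntegrable f volume 0 T) :
    IntervalIntegrable (fun t => (inner ℂ (mild S x₀ f t) (f t)).re) volume 0 T := by
  have h := (intervalIntegrable_growthRate le_rfl ⊥ hT (hS.continuousOn_mild x₀ hf) hf).const_mul 2⁻¹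
  simpa only [growthRate_zero, inv_mul_cancel_left₀ (two_ne_zero' ℝ)] using h

theorem IsContractionSemigroup.supply_add (hS : IsContractionSemigroup S) (x₀ : H) {f : ℝ → H}
    {a b : ℝ} (ha : 0 ≤ a) (hb : 0 ≤ b) (hf : IntervalIntegrable f volume 0 (a + b)) :
    supply S x₀ f (a + b) =
      supply S x₀ f a + supply S (mild S x₀ f a) (fun s => f (a + s)) b := by
  have hab : 0 ≤ a + b := add_nonneg ha hb
  have hsub1 : Set.uIcc 0 a ⊆ Set.uIcc 0 (a + b) := by
    rw [Set.uIcc_of_le ha, Set.uIcc_of_le hab]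
    exact Set.Icc_subset_Icc_right (by linarith)
  have hsub2 : Set.uIcc a (a + b) ⊆ Set.uIcc 0 (a + b) := by
    rw [Set.uIcc_of_le (by linarith), Set.uIcc_of_le hab]
    exact Set.Icc_subset_Icc_left ha
  have hi := hS.intervalIntegrable_re_inner x₀ hab hf
  rw [supply, supply, supply, ← intervalIntegral.integral_add_adjacent_intervals
    (hi.mono_set hsub1) (hi.mono_set hsub2)]
  congr 1
  have h := intervalIntegral.integral_comp_add_left
    (fun t => (inner ℂ (mild S x₀ f t) (f t)).re) (a := 0) (b := b) a
  rw [add_zero] at h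
  rw [← h]
  refine intervalIntegral.integral_congr fun s hs => ?_
  rw [Set.uIcc_of_le hb] at hs
  have hsub3 : Set.uIcc 0 (a + s) ⊆ Set.uIcc 0 (a + b) := by
    rw [Set.uIcc_of_le (add_nonneg ha hs.1), Set.uIcc_of_le hab]
    exact Set.Icc_subset_Icc_right (by linarith [hs.2])
  rw [hS.mild_add x₀ ha hs.1 (hf.mono_set hsub3)]

end Supply

/-! ### Concatenated controls and the competitor -/

section Controls

variable {m : ℕ} {U : Set (EuclideanSpace ℂ (Fin m))}

/-- The control `u` up to time `a`, followed by a second control. -/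
def concat (a : ℝ) (u u' : ℝ → EuclideanSpace ℂ (Fin m)) : ℝ → EuclideanSpace ℂ (Fin m) :=
  (Set.Iic a).piecewise u fun t => u' (t - a)

theorem concat_of_le {a t : ℝ} (u u' : ℝ → EuclideanSpace ℂ (Fin m)) (h : t ≤ a) :
    concat a u u' t = u t :=
  Set.piecewise_eq_of_mem _ _ _ h

theorem concat_add {a t : ℝ} (u u' : ℝ → EuclideanSpace ℂ (Fin m)) (h : 0 < t) :
    concat a u u' (a + t) = u' t := by
  rw [concat, Set.piecewise_eq_of_notMem _ _ _ (by simpa using h), add_sub_cancel_left]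

/-- A bounded measurable function on a bounded interval is square integrable. -/
theorem mem_controls_of_aestronglyMeasurable (hU : Bornology.IsBounded U) {T : ℝ}
    {u : ℝ → EuclideanSpace ℂ (Fin m)}
    (hm : AEStronglyMeasurable u (volume.restrict (Set.Icc 0 T)))
    (hu : ∀ᵐ t ∂(volume.restrict (Set.Icc 0 T)), u t ∈ U) : u ∈ controls U T := by
  obtain ⟨M, hM⟩ := hU.exists_norm_le
  exact ⟨MemLp.of_bound hm M (hu.mono fun t ht => hM _ ht), hu⟩

theorem zero_mem_controls (hU : Bornology.IsBounded U) (hU0 : (0 : EuclideanSpace ℂ (Fin m)) ∈ U)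
    (T : ℝ) : (fun _ => 0) ∈ controls U T :=
  mem_controls_of_aestronglyMeasurable hU aestronglyMeasurable_const
    (Eventually.of_forall fun _ => hU0)

theorem concat_mem_controls (hU : Bornology.IsBounded U) {a b : ℝ}
    {u u' : ℝ → EuclideanSpace ℂ (Fin m)} (hu : u ∈ controls U a) (hu' : u' ∈ controls U b) :
    concat a u u' ∈ controls U (a + b) := by
  have hmp := measurePreserving_sub_right volume a
  refine mem_controls_of_aestronglyMeasurable hU ?_ ?_
  · refine AEStronglyMeasurable.piecewise measurableSet_Iic ?_ ?_
    · rw [Measure.restrict_restrict measurableSet_Iic]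
      exact hu.1.aestronglyMeasurable.mono_measure
        (Measure.restrict_mono (show Set.Iic a ∩ Set.Icc 0 (a + b) ⊆ Set.Icc 0 a from
          fun t ht => ⟨ht.2.1, ht.1⟩) le_rfl)
    · rw [Measure.restrict_restrict measurableSet_Iic.compl]
      have h := hu'.1.aestronglyMeasurable.comp_measurePreserving
        (hmp.restrict_preimage measurableSet_Icc)
      refine h.mono_measure (Measure.restrict_mono (fun t ht => Set.mem_preimage.2 ?_) le_rfl)
      have h1 : a < t := not_le.1 ht.1
      exact Set.mem_Icc.2 ⟨by linarith, by linarith [ht.2.2]⟩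
  · rw [ae_restrict_iff' measurableSet_Icc]
    have h1 := (ae_restrict_iff' measurableSet_Icc).1 hu.2
    have h2 := hmp.quasiMeasurePreserving.ae ((ae_restrict_iff' measurableSet_Icc).1 hu'.2)
    filter_upwards [h1, h2] with t h1 h2 ht
    rcases le_or_gt t a with h | h
    · rw [concat_of_le _ _ h]
      exact h1 ⟨ht.1, h⟩
    · have e : t = a + (t - a) := by ring
      rw [e, concat_add _ _ (by linarith)]
      exact h2 ⟨by linarith, by linarith [ht.2]⟩

variable {H : Type*} [NormedAddCommGroup H] [InnerProductSpace ℂ H] {S : ℝ → H →L[ℂ] H}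

theorem intervalIntegrable_of_mem_controls (B : EuclideanSpace ℂ (Fin m) →L[ℂ] H) {T : ℝ}
    (hT : 0 ≤ T) {u : ℝ → EuclideanSpace ℂ (Fin m)} (hu : u ∈ controls U T) :
    IntervalIntegrable (fun t => B (u t)) volume 0 T := by
  have h1 : Integrable u (volume.restrict (Set.Icc 0 T)) := hu.1.integrable one_le_two
  rw [intervalIntegrable_iff_integrableOn_Icc_of_le hT]
  exact B.integrable_comp h1

variable [CompleteSpace H]

theorem energySupply_eq (B : EuclideanSpace ℂ (Fin m) →L[ℂ] H) (x : H)
    (u : EuclideanSpace ℂ (Fin m)) : energySupply B x u = (inner ℂ x (B u)).re := by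
  rw [energySupply, ContinuousLinearMap.adjoint_inner_right]
  exact inner_re_symm (𝕜 := ℂ) _ _

theorem cost_energySupply (A : H →ₗ.[ℂ] H) (B : EuclideanSpace ℂ (Fin m) →L[ℂ] H) {T : ℝ}
    (hT : 0 ≤ T) (x₀ : H) (u : ℝ → EuclideanSpace ℂ (Fin m)) :
    cost A B (energySupply B) T x₀ u = supply (semigroup A) x₀ (fun t => B (u t)) T := by
  rw [cost, supply]
  refine intervalIntegral.integral_congr fun t ht => ?_
  rw [Set.uIcc_of_le hT] at ht
  simp only [energySupply_eq, mildSolution_eq_mild A B x₀ u ht.1]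

theorem IsContractionSemigroup.mild_concat (hS : IsContractionSemigroup S)
    (B : EuclideanSpace ℂ (Fin m) →L[ℂ] H) (hU : Bornology.IsBounded U) {a b : ℝ} (ha : 0 ≤ a)
    (hb : 0 ≤ b) {u u' : ℝ → EuclideanSpace ℂ (Fin m)} (hu : u ∈ controls U a)
    (hu' : u' ∈ controls U b) (x₀ : H) :
    mild S x₀ (fun t => B (concat a u u' t)) (a + b) =
      mild S (mild S x₀ (fun t => B (u t)) a) (fun t => B (u' t)) b := by
  rw [hS.mild_add x₀ ha hb (intervalIntegrable_of_mem_controls B (add_nonneg ha hb)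
    (concat_mem_controls hU hu hu')),
    mild_congr_of_eqOn (T := a) (g := fun t => B (u t))
      (fun t ht => by simp only [concat_of_le _ _ ht.2]) (Set.right_mem_Icc.2 ha)]
  exact mild_congr_of_eqOn (T := b) (fun t ht => by simp only [concat_add _ _ ht.1])
    (Set.right_mem_Icc.2 hb)

theorem IsContractionSemigroup.supply_concat (hS : IsContractionSemigroup S)
    (B : EuclideanSpace ℂ (Fin m) →L[ℂ] H) (hU : Bornology.IsBounded U) {a b : ℝ} (ha : 0 ≤ a)
    (hb : 0 ≤ b) {u u' : ℝ → EuclideanSpace ℂ (Fin m)} (hu : u ∈ controls U a)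
    (hu' : u' ∈ controls U b) (x₀ : H) :
    supply S x₀ (fun t => B (concat a u u' t)) (a + b) =
      supply S x₀ (fun t => B (u t)) a +
        supply S (mild S x₀ (fun t => B (u t)) a) (fun t => B (u' t)) b := by
  have h1 : Set.EqOn (fun t => B (concat a u u' t)) (fun t => B (u t)) (Set.Ioc 0 a) :=
    fun t ht => by simp only [concat_of_le _ _ ht.2]
  rw [hS.supply_add x₀ ha hb (intervalIntegrable_of_mem_controls B (add_nonneg ha hb)
    (concat_mem_controls hU hu hu')), supply_congr ha h1,
    mild_congr_of_eqOn h1 (Set.right_mem_Icc.2 ha)]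
  congr 1
  exact supply_congr hb fun t ht => by simp only [concat_add _ _ ht.1]

theorem exists_control_of_mem_reachable {A : H →ₗ.[ℂ] H}
    {B : EuclideanSpace ℂ (Fin m) →L[ℂ] H} (hU : Bornology.IsBounded U)
    (hU0 : (0 : EuclideanSpace ℂ (Fin m)) ∈ U) {x₁ : H} (h : x₁ ∈ reachable A B U 0) :
    ∃ T, 0 < T ∧ ∃ u ∈ controls U T, mild (semigroup A) 0 (fun t => B (u t)) T = x₁ := by
  simp only [reachable, Set.mem_iUnion] at h
  obtain ⟨T, -, ⟨-, rfl⟩ | ⟨hT, u, hu, hux⟩⟩ := h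
  -- Reachability at time zero means that the target is the origin; resting there for one unit of
  -- time gives a positive duration.
  · refine ⟨1, one_pos, fun _ => 0, zero_mem_controls hU hU0 1, ?_⟩
    simp only [map_zero]
    exact mild_zero_zero 1
  · exact ⟨T, hT, u, hu, by rw [← mildSolution_eq_mild A B 0 u hT.le, hux]⟩

/-- Steering first to the origin, then resting there and finally moving to the target gives an
admissible control whose energy supply is bounded independently of the horizon. -/
theorem exists_admissibleControl_supply_le {A : H →ₗ.[ℂ] H}
    (hS : IsContractionSemigroup (semigroup A)) (B : EuclideanSpace ℂ (Fin m) →L[ℂ] H)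
    (hU : Bornology.IsBounded U) (hU0 : (0 : EuclideanSpace ℂ (Fin m)) ∈ U) {b : ℝ} (hb : 0 ≤ b)
    (hBb : ∀ v ∈ U, ‖B v‖ ≤ b) {T₀ T₁ T : ℝ} (hT₀ : 0 ≤ T₀) (hT₁ : 0 ≤ T₁) (hT : T₀ + T₁ ≤ T)
    {x₀ x₁ : H} {u u' : ℝ → EuclideanSpace ℂ (Fin m)} (hu : u ∈ controls U T₀)
    (hu0 : mild (semigroup A) x₀ (fun t => B (u t)) T₀ = 0) (hu' : u' ∈ controls U T₁)
    (hu1 : mild (semigroup A) 0 (fun t => B (u' t)) T₁ = x₁) :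
    ∃ v ∈ admissibleControls A B U T x₀ x₁, cost A B (energySupply B) T x₀ v ≤
      (‖x₀‖ + b * T₀) * b * T₀ + b * T₁ * b * T₁ := by
  have hbound : ∀ {T : ℝ} {u : ℝ → EuclideanSpace ℂ (Fin m)}, u ∈ controls U T →
      ∀ᵐ t, t ∈ Set.Icc 0 T → ‖B (u t)‖ ≤ b := fun hu => by
    filter_upwards [(ae_restrict_iff' measurableSet_Icc).1 hu.2] with t ht htT
    exact hBb _ (ht htT)
  -- The resting time. It alone depends on the horizon, and it contributes no supply because the
  -- state stays at zero.
  set a : ℝ := T - T₀ - T₁ with ha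
  have ha0 : 0 ≤ a := by linarith
  have hz := zero_mem_controls hU hU0 a
  have hc := concat_mem_controls hU hz hu'
  have hsum : T₀ + (a + T₁) = T := by rw [ha]; ring
  have hT0 : 0 ≤ T := by linarith
  have h0 : mild (semigroup A) 0 (fun _ => B 0) a = 0 := by
    simp only [map_zero]
    exact mild_zero_zero a
  have hmem := concat_mem_controls hU hu hc
  have hmild := hS.mild_concat B hU hT₀ (add_nonneg ha0 hT₁) hu hc x₀
  have hsupply := hS.supply_concat B hU hT₀ (add_nonneg ha0 hT₁) hu hc x₀
  rw [hu0, hS.mild_concat B hU ha0 hT₁ hz hu', h0, hu1] at hmild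
  rw [hu0, hS.supply_concat B hU ha0 hT₁ hz hu', h0] at hsupply
  rw [hsum] at hmem hmild hsupply
  refine ⟨_, ⟨hmem, ?_⟩, ?_⟩
  · rw [mildSolution_eq_mild A B x₀ _ hT0, hmild]
  · have e : supply (semigroup A) 0 (fun _ => B 0) a = 0 := by
      simp only [map_zero]
      exact supply_zero_zero a
    rw [cost_energySupply A B hT0, hsupply, e, zero_add]
    have h1 := hS.supply_le x₀ hT₀ hb (intervalIntegrable_of_mem_controls B hT₀ hu) (hbound hu)
    have h2 := hS.supply_le 0 hT₁ hb (intervalIntegrable_of_mem_controls B hT₁ hu') (hbound hu')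
    rw [norm_zero, zero_add] at h2
    exact add_le_add h1 h2

end Controls

/-! ### From the energy balance to the turnpike property -/

section Turnpike

variable {H : Type*} [NormedAddCommGroup H] [InnerProductSpace ℂ H] {S : ℝ → H →L[ℂ] H}
  [CompleteSpace H]

/-- The energy balance bounds the distance to `V` by the supplied energy and the initial energy. -/
theorem IsContractionSemigroup.mul_integral_infDist_sq_le (hS : IsContractionSemigroup S)
    {A : H →ₗ.[ℂ] H} {ω : ℝ} (hAm : IsMDissipative A ω) (hA : IsGeneratorOf A S) {c : ℝ}
    (hc : 0 ≤ c) {V : Submodule ℂ H}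
    (hV : ∀ x : A.domain, (inner ℂ (x : H) (A x)).re ≤ -(c * Metric.infDist (x : H) V ^ 2))
    (x₀ : H) {f : ℝ → H} {T : ℝ} (hT : 0 ≤ T) (hf : IntervalIntegrable f volume 0 T) :
    c * ∫ t in (0 : ℝ)..T, Metric.infDist (mild S x₀ f t) V ^ 2 ≤
      supply S x₀ f T + ‖x₀‖ ^ 2 / 2 := by
  have h := hS.sq_norm_mild_le hAm hA hc hV x₀ hT hf
  have hd : IntervalIntegrable (fun t => Metric.infDist (mild S x₀ f t) (V : Set H) ^ 2)
      volume 0 T := by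
    refine ContinuousOn.intervalIntegrable ?_
    rw [Set.uIcc_of_le hT]
    exact ((Metric.continuous_infDist_pt _).comp_continuousOn (hS.continuousOn_mild x₀ hf)).pow 2
  simp only [growthRate] at h
  rw [intervalIntegral.integral_const_mul, intervalIntegral.integral_sub
    (hS.intervalIntegrable_re_inner x₀ hT hf) (hd.const_mul c),
    intervalIntegral.integral_const_mul] at h
  rw [supply]
  -- The terminal energy is discarded, being non-negative.
  have := sq_nonneg ‖mild S x₀ f T‖
  linarith

end Turnpike

end PortHamiltonian

end


theorem theorem3p2 {H : Type*} [NormedAddCommGroup H] [InnerProductSpace ℂ H] [CompleteSpace H]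
    [TopologicalSpace.SeparableSpace H] {m : ℕ}
    (J R : H →ₗ.[ℂ] H)
    (hJ : PortHamiltonian.IsSkewAdjoint J)
    (hR : IsSelfAdjoint R) (hR0 : PortHamiltonian.IsNonneg R)
    (hJR : PortHamiltonian.IsRelBoundedLtOne J R ∨ PortHamiltonian.IsRelBoundedLtOne R J)
    (B : EuclideanSpace ℂ (Fin m) →L[ℂ] H)
    (U : Set (EuclideanSpace ℂ (Fin m)))
    (hUc : IsCompact U) (hUconv : Convex ℝ U) (hU0 : (0 : EuclideanSpace ℂ (Fin m)) ∈ interior U)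
    (hspec : (0 : ℂ) ∈ PortHamiltonian.discreteSpectrum R ∪ PortHamiltonian.resolventSet R)
    (T₀ : ℝ) (hT₀ : 0 < T₀) (xT : H)
    (hxT : xT ∈ PortHamiltonian.reachable (J - R) B U 0) :
    PortHamiltonian.HasStateIntegralTurnpike (J - R) B U (PortHamiltonian.energySupply B) xT
      {x₀ : H | (0 : H) ∈ PortHamiltonian.reachableAt (J - R) B U T₀ x₀}
      (PortHamiltonian.kernel R) := by
  open PortHamiltonian in
  obtain ⟨ω, hA⟩ := exists_isMDissipative_sub hJ hR hR0 hJR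
  obtain ⟨hS₀, hgen⟩ := semigroup_spec hA.isGenerator
  have hS := hS₀.isContractionSemigroup hgen hA.dense hA.dissipative
  obtain ⟨c, hc, hgap⟩ := hR0.exists_mul_infDist_sq_le hR hspec
  have hV : ∀ x : (J - R).domain, (inner ℂ (x : H) ((J - R) x)).re ≤
      -(c * Metric.infDist (x : H) (kernel R) ^ 2) := fun x => by
    rw [re_inner_sub_apply hJ]
    exact neg_le_neg (hgap ⟨x, x.2.2⟩)
  have hUb := hUc.isBounded
  have hU0' := interior_subset hU0
  obtain ⟨M, hM⟩ := hUb.exists_norm_le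
  have hM0 : 0 ≤ M := (norm_nonneg _).trans (hM 0 hU0')
  set b : ℝ := ‖B‖ * M with hb
  have hb0 : 0 ≤ b := by positivity
  have hBb : ∀ v ∈ U, ‖B v‖ ≤ b := fun v hv =>
    (B.le_opNorm v).trans (mul_le_mul_of_nonneg_left (hM v hv) (norm_nonneg _))
  obtain ⟨T₁, hT₁, u₁, hu₁, hux₁⟩ := exists_control_of_mem_reachable hUb hU0' hxT
  -- `F` is the competitor's supply bound plus the initial energy, divided by the gap constant `c`;
  -- it is continuous because it depends on `x₀` only through its norm. `τ = T₀ + T₁` leaves time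
  -- for both transfers.
  refine ⟨fun x₀ => Real.toNNReal
      (((‖(x₀ : H)‖ + b * T₀) * b * T₀ + b * T₁ * b * T₁ + ‖(x₀ : H)‖ ^ 2 / 2) / c),
    fun _ => Real.toNNReal (T₀ + T₁), ?_, continuous_const, ?_⟩
  · exact continuous_real_toNNReal.comp (by fun_prop)
  · rintro ⟨x₀, hx₀⟩ T hT x u ⟨⟨hu, -⟩, hx, hopt⟩
    have hT' : T₀ + T₁ < T := (Real.le_coe_toNNReal _).trans_lt hT
    have hT0 : 0 ≤ T := by linarith
    obtain ⟨h, -⟩ | ⟨-, u₀, hu₀, hux₀⟩ := (show 0 ∈ reachableAt (J - R) B U T₀ x₀ from hx₀)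
    · exact absurd h hT₀.ne'
    rw [mildSolution_eq_mild _ B x₀ u₀ hT₀.le] at hux₀
    obtain ⟨v, hv, hcost⟩ := exists_admissibleControl_supply_le hS B hUb hU0' hb0 hBb hT₀.le
      hT₁.le hT'.le hu₀ hux₀ hu₁ hux₁
    have hf := intervalIntegrable_of_mem_controls B hT0 hu
    have hxm : ∀ t ∈ Set.Icc 0 T, x t = mild (semigroup (J - R)) x₀ (fun s => B (u s)) t :=
      fun t ht => by rw [hx t ht, mildSolution_eq_mild _ B x₀ u ht.1]
    constructor
    · refine ContinuousOn.intervalIntegrable ?_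
      rw [Set.uIcc_of_le hT0]
      exact ((Metric.continuous_infDist_pt _).comp_continuousOn
        ((hS.continuousOn_mild x₀ hf).congr hxm)).pow 2
    · have e : ∫ t in (0 : ℝ)..T, Metric.infDist (x t) (kernel R : Set H) ^ 2 =
          ∫ t in (0 : ℝ)..T, Metric.infDist (mild (semigroup (J - R)) x₀ (fun s => B (u s)) t)
            (kernel R : Set H) ^ 2 := by
        refine intervalIntegral.integral_congr fun t ht => ?_
        rw [Set.uIcc_of_le hT0] at ht
        simp only [hxm t ht]
      have h1 := hS.mul_integral_infDist_sq_le hA hgen hc.le hV x₀ hT0 hf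
      -- The only use of optimality: comparison with the competitor `v`.
      have h2 := (hopt v hv).trans hcost
      rw [cost_energySupply _ B hT0] at h2
      rw [e]
      refine le_trans ?_ (Real.le_coe_toNNReal _)
      rw [le_div_iff₀ hc, mul_comm]
      linarith
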